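/- Let $N\le M$. Consider $N$ data modes and $M$ ancilla modes, with displacement operators $D_\zeta$ satisfying $D_{\zeta+\nu}=e^{i\omega(\zeta,\nu)/2}D_\zeta D_\nu$, where $\omega$ is the symplectic form. States are represented by their characteristic functions $\chi(\zeta)=\mathrm{Tr}(\rho D_{-\zeta})$ (no continuity is required, so ideal non-normalizable lattice states are included), and a symplectic matrix $S$ acts by $\mathcal U_S:\chi\mapsto\chi\circ S^{-1}$, i.e. $\rho\mapsto U_S\rho U_S^\dagger$ with $U_S^\dagger D_\zeta U_S=D_{S^{-1}\zeta}$. An oscillators-to-oscillators (O2O) code with Gaussian encoding consists of a symplectic matrix $S_{\rm enc}\in \mathrm{Sp}(2(N+M),\mathbb R)$, an arbitrary (in particular non-Gaussian) ancilla state $\tau$, a measurement of the ancilla with effects $E(\cdot)$ and outcome (syndrome) $s$ in a measurable space, and a measurable estimator $s\mapsto f(s)\in\mathbb R^{2N}$. Under i.i.d. additive Gaussian noise of variance $\sigma^2$ on every quadrature of all $N+M$ modes it induces on the data the channel $\mathcal C_\sigma$: append $\tau$, apply $U_{S_{\rm enc}}$, apply the noise, apply $U_{S_{\rm enc}}^{-1}$,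 measure the ancilla, apply $D_{-f(s)}$ to the data, and discard $s$ and the ancilla. A lattice (GKP) code is a code whose ancilla state is a simultaneous $+1$ eigenstate of the stabilizers $D_{\sqrt{2\pi}\,v_j}$ of a full-rank symplectically integral lattice in $\mathbb R^{2M}$ with generator matrix $L=(v_1,\dots,v_{2M})$ (that is, $\omega(v_j,v_k)\in\mathbb Z$), and whose measurement is the joint measurement of these stabilizers. For gains $G_1,\dots,G_N\ge1$ let $T_G$ be the symplectic matrix of $N$ two-mode squeezers, the $i$-th of which acts on data mode $i$ and ancilla mode $i$ by $$\begin{pmatrix}\sqrt{G_i}\,I&\sqrt{G_i-1}\,Z\\ \sqrt{G_i-1}\,Z&\sqrt{G_i}\,I\end{pmatrix},\qquad Z=\mathrm{diag}(1,-1),$$ and which leaves the remaining $M-N$ ancilla modes alone. Then for every $S_{\rm enc}$ there are gains $G_1,\dots,G_N\ge 1$ and local symplectic matrices $A\in\mathrm{Sp}(2N,\mathbb R)$ (data) and $B\in\mathrm{Sp}(2M,\mathbb R)$ (ancilla), depending on $S_{\rm enc}$ only, such that: 1. for every $\sigma\ge0$, $(A\oplus B)\,\sigma^2S_{\rm enc}^{-1}S_{\rm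 enc}^{-\top}(A\oplus B)^\top=\sigma^2T_G^{-1}T_G^{-\top}$; 2. for every O2O code with encoding $S_{\rm enc}$, the two-mode-squeezing code with encoding $T_G$, ancilla state $U_B\tau U_B^\dagger$, measurement conjugated with $U_B$ (effects $U_BE(\cdot)U_B^\dagger$), and estimator $A f(s)$ induces, for every $\sigma\ge 0$, a channel $\mathcal C'_\sigma$ which agrees with the channel $\mathcal C_\sigma$ of the original code up to the local Gaussian unitary $U_A$ on the data: $\mathcal C'_\sigma\circ\mathcal U_A=\mathcal U_A\circ\mathcal C_\sigma$ on all data states; 3. if the original code is a lattice code for a lattice with generator matrix $L$, then this two-mode-squeezing code is a lattice code for the lattice with generator matrix $BL$. -/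

import Mathlib

open MeasureTheory ProbabilityTheory
open scoped NNReal ComplexOrder Matrix

noncomputable section

namespace O2O

/-! ### Phase space -/

/-- Phase space of a set `ι` of bosonic modes. The coordinate `Sum.inl i` is the position and
`Sum.inr i` the momentum of mode `i`. -/
abbrev Phase (ι : Type*) := ι ⊕ ι → ℝ

/-- The symplectic form `ω(ζ, ν) = ζᵀ Ω ν = ∑ i, (q i * p' i - p i * q' i)`. -/
def omega {ι : Type*} [Fintype ι] (ζ ν : Phase ι) : ℝ :=
  ∑ i, (ζ (Sum.inl i) * ν (Sum.inr i) - ζ (Sum.inr i) * ν (Sum.inl i))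

/-- The part of a joint phase-space vector that belongs to the first group of modes. -/
def fstPart {α β : Type*} (ζ : Phase (α ⊕ β)) : Phase α :=
  Sum.elim (fun i => ζ (Sum.inl (Sum.inl i))) (fun i => ζ (Sum.inr (Sum.inl i)))

/-- The part of a joint phase-space vector that belongs to the second group of modes. -/
def sndPart {α β : Type*} (ζ : Phase (α ⊕ β)) : Phase β :=
  Sum.elim (fun i => ζ (Sum.inl (Sum.inr i))) (fun i => ζ (Sum.inr (Sum.inr i)))

/-- The joint phase-space vector `ζ ⊕ ν`. -/
def joinPhase {α β : Type*} (ζ : Phase α) (ν : Phase β) : Phase (α ⊕ β) :=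
  Sum.elim (Sum.elim (fun i => ζ (Sum.inl i)) (fun i => ν (Sum.inl i)))
    (Sum.elim (fun i => ζ (Sum.inr i)) (fun i => ν (Sum.inr i)))

/-- The block sum `A ⊕ B` of two phase-space matrices, acting locally on the two groups of
modes. -/
def localSum {α β : Type*} (A : Matrix (α ⊕ α) (α ⊕ α) ℝ) (B : Matrix (β ⊕ β) (β ⊕ β) ℝ) :
    Matrix ((α ⊕ β) ⊕ (α ⊕ β)) ((α ⊕ β) ⊕ (α ⊕ β)) ℝ :=
  (Matrix.fromBlocks A 0 0 B).submatrix
    (Equiv.sumSumSumComm α β α β) (Equiv.sumSumSumComm α β α β)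

/-! ### Quantum states

A state `ρ` (a normalized positive functional on the algebra generated by the displacement
operators) is represented by its characteristic function `χ ζ = Tr (ρ D_{-ζ})`, where
`D_{ζ+ν} = exp (i ω(ζ,ν) / 2) D_ζ D_ν`. No continuity is required, so that both density operators
and the ideal, non-normalizable, lattice states are covered. -/

/-- Characteristic functions (of not necessarily positive functionals). -/
abbrev CharFn (ι : Type*) := Phase ι → ℂ

/-- Positivity `Tr (ρ X† X) ≥ 0` for every `X = ∑ k, c k • D_{ζ k}`; note that
`D_{ζ j}† D_{ζ k} = exp (i ω(ζ j, ζ k) / 2) D_{ζ k - ζ j}`. -/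
def IsPositive {ι : Type*} [Fintype ι] (χ : CharFn ι) : Prop :=
  ∀ (n : ℕ) (c : Fin n → ℂ) (ζ : Fin n → Phase ι),
    0 ≤ ∑ j, ∑ k, star (c j) * c k *
      Complex.exp (Complex.I * ((omega (ζ j) (ζ k) / 2 : ℝ) : ℂ)) * χ (ζ j - ζ k)

/-- Quantum states of the modes `ι`. -/
structure IsState {ι : Type*} [Fintype ι] (χ : CharFn ι) : Prop where
  pos : IsPositive χ
  norm_one : χ 0 = 1

/-- The product state `ρ ⊗ τ`. -/
def tensor {α β : Type*} (χ : CharFn α) (τ : CharFn β) : CharFn (α ⊕ β) :=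
  fun ζ => χ (fstPart ζ) * τ (sndPart ζ)

/-- The Gaussian unitary channel `ρ ↦ U_S ρ U_S†` of a symplectic matrix `S`, where
`U_S† D_ζ U_S = D_{S⁻¹ ζ}`. -/
def gaussian {ι : Type*} [Fintype ι] [DecidableEq ι] (S : Matrix (ι ⊕ ι) (ι ⊕ ι) ℝ)
    (χ : CharFn ι) : CharFn ι :=
  fun ζ => χ (S⁻¹ *ᵥ ζ)

/-- The displacement `ρ ↦ D_ξ ρ D_ξ†`; here `D_ξ† D_{-ζ} D_ξ = exp (i ω(ζ, ξ)) D_{-ζ}`. -/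
def displace {ι : Type*} [Fintype ι] (ξ : Phase ι) (χ : CharFn ι) : CharFn ι :=
  fun ζ => Complex.exp (Complex.I * (omega ζ ξ : ℂ)) * χ ζ

/-- The independent identically distributed additive Gaussian noise channel: every quadrature is
displaced by an independent centred Gaussian variable of variance `σ ^ 2`. -/
def agn {ι : Type*} [Fintype ι] (σ : ℝ≥0) (χ : CharFn ι) : CharFn ι :=
  fun ζ => ∫ ξ : Phase ι, displace ξ χ ζ ∂(Measure.pi fun _ => gaussianReal 0 (σ ^ 2))

/-! ### Measurements -/

/-- A measurement (positive operator valued measure) on the modes `ι` with outcomes in `Y`, given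
by its linear outcome rule `ρ ↦ (B ↦ Tr (ρ E(B)))`. It is positive and normalized on positive
functionals; its values outside the linear span of these play no role. -/
structure Measurement (ι : Type*) [Fintype ι] (Y : Type*) [MeasurableSpace Y] where
  rule : CharFn ι →ₗ[ℂ] ComplexMeasure Y
  nonneg : ∀ χ, IsPositive χ → ∀ B, MeasurableSet B → 0 ≤ rule χ B
  total : ∀ χ, IsPositive χ → rule χ Set.univ = χ 0

/-- Pull-back of characteristic functions along a linear map of phase space. -/
def pullback {ι : Type*} [Fintype ι] (S : Matrix (ι ⊕ ι) (ι ⊕ ι) ℝ) :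
    CharFn ι →ₗ[ℂ] CharFn ι where
  toFun χ := fun ζ => χ (S *ᵥ ζ)
  map_add' _ _ := rfl
  map_smul' _ _ := rfl

/-- The symplectic form through Mathlib's matrix `J = -Ω`. -/
theorem omega_eq {ι : Type*} [Fintype ι] [DecidableEq ι] (ζ ν : Phase ι) :
    omega ζ ν = - (ζ ⬝ᵥ (Matrix.J ι ℝ *ᵥ ν)) := by
  have h : ν = Sum.elim (fun i => ν (Sum.inl i)) (fun i => ν (Sum.inr i)) := by
    ext i; cases i <;> rfl
  rw [Matrix.J, h, Matrix.fromBlocks_mulVec]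
  simp [omega, dotProduct, Fintype.sum_sum_type, Matrix.neg_mulVec, Finset.sum_sub_distrib]
  ring_nf

theorem omega_mulVec {ι : Type*} [Fintype ι] [DecidableEq ι] {S : Matrix (ι ⊕ ι) (ι ⊕ ι) ℝ}
    (hS : S ∈ Matrix.symplecticGroup ι ℝ) (ζ ν : Phase ι) :
    omega (S *ᵥ ζ) (S *ᵥ ν) = omega ζ ν := by
  rw [omega_eq, omega_eq, Matrix.mulVec_mulVec, Matrix.dotProduct_mulVec, Matrix.vecMul_mulVec,
    ← Matrix.dotProduct_mulVec, ← Matrix.mul_assoc, SymplecticGroup.mem_iff'.1 hS]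

theorem isPositive_pullback {ι : Type*} [Fintype ι] [DecidableEq ι]
    {S : Matrix (ι ⊕ ι) (ι ⊕ ι) ℝ} (hS : S ∈ Matrix.symplecticGroup ι ℝ) {χ : CharFn ι}
    (h : IsPositive χ) : IsPositive (pullback S χ) := by
  intro n c ζ
  have := h n c (fun k => S *ᵥ ζ k)
  simpa [omega_mulVec hS, pullback, Matrix.mulVec_sub] using this

theorem inv_mem_symplecticGroup {ι : Type*} [Fintype ι] [DecidableEq ι]
    {S : Matrix (ι ⊕ ι) (ι ⊕ ι) ℝ} (hS : S ∈ Matrix.symplecticGroup ι ℝ) :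
    S⁻¹ ∈ Matrix.symplecticGroup ι ℝ := by
  have := (⟨S, hS⟩ : Matrix.symplecticGroup ι ℝ)⁻¹.2
  rwa [SymplecticGroup.coe_inv'] at this

theorem isState_gaussian {ι : Type*} [Fintype ι] [DecidableEq ι]
    {S : Matrix (ι ⊕ ι) (ι ⊕ ι) ℝ} (hS : S ∈ Matrix.symplecticGroup ι ℝ) {χ : CharFn ι}
    (h : IsState χ) : IsState (gaussian S χ) :=
  ⟨isPositive_pullback (inv_mem_symplecticGroup hS) h.pos, by simp [gaussian, h.norm_one]⟩

/-- The conjugated measurement with effects `U_S E(B) U_S†`: undo `U_S`, then measure. -/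
def Measurement.conj {ι : Type*} [Fintype ι] [DecidableEq ι] {Y : Type*} [MeasurableSpace Y]
    (P : Measurement ι Y) (S : Matrix (ι ⊕ ι) (ι ⊕ ι) ℝ)
    (hS : S ∈ Matrix.symplecticGroup ι ℝ) : Measurement ι Y where
  rule := P.rule ∘ₗ pullback S
  nonneg χ h B hB := P.nonneg _ (isPositive_pullback hS h) B hB
  total χ h := by
    rw [LinearMap.comp_apply, P.total _ (isPositive_pullback hS h)]
    simp [pullback]

/-! ### Oscillators-to-oscillators codes -/

/-- A code that protects `N` data modes with `M` ancilla modes: a symplectic encoding, an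
(arbitrary) ancilla state, a measurement of the ancilla that produces the syndrome `s`, and an
estimator `s ↦ f(s)` of the data displacement. -/
structure Code (N M : ℕ) (Y : Type*) [MeasurableSpace Y] where
  enc : Matrix ((Fin N ⊕ Fin M) ⊕ (Fin N ⊕ Fin M)) ((Fin N ⊕ Fin M) ⊕ (Fin N ⊕ Fin M)) ℝ
  enc_mem : enc ∈ Matrix.symplecticGroup (Fin N ⊕ Fin M) ℝ
  ancilla : CharFn (Fin M)
  ancilla_state : IsState ancilla
  meas : Measurement (Fin M) Y
  est : Y → Phase (Fin N)
  est_measurable : Measurable est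

variable {N M : ℕ} {Y : Type*} [MeasurableSpace Y]

/-- The joint state of data and ancilla just before the syndrome measurement: append the ancilla,
encode, apply the noise, decode. -/
def Code.decoded (C : Code N M Y) (σ : ℝ≥0) (ρ : CharFn (Fin N)) : CharFn (Fin N ⊕ Fin M) :=
  gaussian C.enc⁻¹ (agn σ (gaussian C.enc (tensor ρ C.ancilla)))

/-- The channel that the code induces on the data: measure the ancilla, apply `D_{-f(s)}` to the
data, forget the syndrome. For fixed `ζ`, `C.meas.rule (fun ν => C.decoded σ ρ (joinPhase ζ ν))`
is the complex measure `B ↦ Tr (ρ_dec (D_{-ζ} ⊗ E(B)))`. -/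
def Code.channel (C : Code N M Y) (σ : ℝ≥0) (ρ : CharFn (Fin N)) : CharFn (Fin N) :=
  fun ζ =>
    (C.meas.rule (fun ν => C.decoded σ ρ (joinPhase ζ ν))).integral
      (fun s => Complex.exp (Complex.I * (omega ζ (-C.est s) : ℂ))) (ContinuousLinearMap.mul ℝ ℂ)

/-! ### Two-mode-squeezing codes -/

/-- The action of `N` two-mode squeezers with gains `G i`, the `i`th one between data mode `i` and
ancilla mode `i`, on the positions (`e = 1`) or on the momenta (`e = -1`). The ancilla modes
`N, …, M - 1` are left alone. -/
def tmsQuad (e : ℝ) (G : Fin N → ℝ) : Matrix (Fin N ⊕ Fin M) (Fin N ⊕ Fin M) ℝ :=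
  Matrix.fromBlocks
    (Matrix.diagonal fun i => √(G i))
    (Matrix.of fun i a => if (i : ℕ) = a then e * √(G i - 1) else 0)
    (Matrix.of fun a i => if (i : ℕ) = a then e * √(G i - 1) else 0)
    (Matrix.diagonal fun a => if h : (a : ℕ) < N then √(G ⟨a, h⟩) else 1)

/-- The symplectic matrix of `N` two-mode squeezers: on the `i`th pair of modes it is
`[[√G I, √(G - 1) Z], [√(G - 1) Z, √G I]]` with `G = G i`. -/
def tms (G : Fin N → ℝ) :
    Matrix ((Fin N ⊕ Fin M) ⊕ (Fin N ⊕ Fin M)) ((Fin N ⊕ Fin M) ⊕ (Fin N ⊕ Fin M)) ℝ :=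
  Matrix.fromBlocks (tmsQuad 1 G) 0 0 (tmsQuad (-1) G)

theorem tmsQuad_transpose (e : ℝ) (G : Fin N → ℝ) :
    (tmsQuad e G : Matrix (Fin N ⊕ Fin M) (Fin N ⊕ Fin M) ℝ)ᵀ = tmsQuad e G := by
  rw [tmsQuad, Matrix.fromBlocks_transpose, Matrix.diagonal_transpose, Matrix.diagonal_transpose]
  rfl

theorem tmsQuad_mul (hNM : N ≤ M) {G : Fin N → ℝ} (hG : ∀ i, 1 ≤ G i) :
    (tmsQuad 1 G : Matrix (Fin N ⊕ Fin M) (Fin N ⊕ Fin M) ℝ) * tmsQuad (-1) G = 1 := by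
  have h1 : ∀ i, √(G i) * √(G i) = G i := fun i => Real.mul_self_sqrt (by linarith [hG i])
  have h2 : ∀ i, √(G i - 1) * √(G i - 1) = G i - 1 :=
    fun i => Real.mul_self_sqrt (by linarith [hG i])
  rw [tmsQuad, tmsQuad, Matrix.fromBlocks_multiply, ← Matrix.fromBlocks_one]
  congr 1
  · ext i j
    rw [Matrix.add_apply, Matrix.diagonal_mul_diagonal, Matrix.mul_apply,
      Finset.sum_eq_single (Fin.castLE hNM i)]
    · by_cases hij : i = j
      · subst hij
        simp [h1, h2]
      · have : ¬ (j : ℕ) = i := fun h => hij (Fin.ext h.symm)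
        simp [hij, this]
    · intro b _ hb
      have : ¬ (i : ℕ) = b := fun h => hb (Fin.ext h.symm)
      simp [this]
    · simp
  · ext i a
    rw [Matrix.add_apply, Matrix.diagonal_mul, Matrix.mul_diagonal]
    by_cases hia : (i : ℕ) = a
    · have ha : (a : ℕ) < N := hia ▸ i.2
      have : (⟨a, ha⟩ : Fin N) = i := Fin.ext hia.symm
      simp [hia, ha, this, mul_comm]
    · simp [hia]
  · ext a i
    rw [Matrix.add_apply, Matrix.diagonal_mul, Matrix.mul_diagonal]
    by_cases hia : (i : ℕ) = a
    · have ha : (a : ℕ) < N := hia ▸ i.2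
      have : (⟨a, ha⟩ : Fin N) = i := Fin.ext hia.symm
      simp [hia, ha, this, mul_comm]
    · simp [hia]
  · ext a b
    rw [Matrix.add_apply, Matrix.diagonal_mul_diagonal, Matrix.mul_apply]
    by_cases ha : (a : ℕ) < N
    · rw [Finset.sum_eq_single (⟨a, ha⟩ : Fin N)]
      · by_cases hab : a = b
        · subst hab
          simp [ha, h1, h2]
        · have : ¬ (a : ℕ) = b := fun h => hab (Fin.ext h)
          simp [hab, this]
      · intro i _ hi
        have : ¬ (i : ℕ) = a := fun h => hi (Fin.ext h)
        simp [this]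
      · simp
    · rw [Finset.sum_eq_zero]
      · by_cases hab : a = b
        · subst hab
          simp [ha]
        · simp [hab]
      · intro i _
        have : ¬ (i : ℕ) = a := fun h => ha (h ▸ i.2)
        simp [this]

theorem tms_mem (hNM : N ≤ M) {G : Fin N → ℝ} (hG : ∀ i, 1 ≤ G i) :
    (tms G : Matrix ((Fin N ⊕ Fin M) ⊕ (Fin N ⊕ Fin M)) _ ℝ) ∈
      Matrix.symplecticGroup (Fin N ⊕ Fin M) ℝ := by
  have h := tmsQuad_mul hNM hG
  have h' := mul_eq_one_comm.1 h
  rw [SymplecticGroup.mem_iff, tms, Matrix.fromBlocks_transpose, tmsQuad_transpose,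
    tmsQuad_transpose, Matrix.J, Matrix.fromBlocks_multiply, Matrix.fromBlocks_multiply]
  simp [h, h']

/-- The two-mode-squeezing code with gains `G` that is obtained from a code `C` and local symplectic
matrices `A` (data) and `B` (ancilla): the encoding consists of `N` two-mode squeezers, the ancilla
is prepared in the state `U_B τ U_B†` instead of `τ`, its measurement is conjugated with `U_B`, and
the estimator is `A f(s)` instead of `f(s)`. -/
def Code.toTMS (C : Code N M Y) (hNM : N ≤ M) (G : Fin N → ℝ) (hG : ∀ i, 1 ≤ G i)
    (A : Matrix (Fin N ⊕ Fin N) (Fin N ⊕ Fin N) ℝ)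
    (B : Matrix (Fin M ⊕ Fin M) (Fin M ⊕ Fin M) ℝ)
    (hB : B ∈ Matrix.symplecticGroup (Fin M) ℝ) : Code N M Y where
  enc := tms G
  enc_mem := tms_mem hNM hG
  ancilla := gaussian B C.ancilla
  ancilla_state := isState_gaussian hB C.ancilla_state
  meas := C.meas.conj B hB
  est := fun s => A *ᵥ C.est s
  est_measurable :=
    (Continuous.matrix_mulVec continuous_const continuous_id).measurable.comp C.est_measurable

/-! ### Lattice states and lattice codes -/

/-- The lattice generated by the columns of `L` is symplectically integral (`ω(v_j, v_k) ∈ ℤ`) and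
has full rank (the symplectic Gram matrix is nonsingular). -/
def IsLatticeGenerator (L : Matrix (Fin M ⊕ Fin M) (Fin (2 * M)) ℝ) : Prop :=
  ∃ A : Matrix (Fin (2 * M)) (Fin (2 * M)) ℤ,
    (∀ j k, omega (fun a => L a j) (fun a => L a k) = A j k) ∧ A.det ≠ 0

/-- A lattice state `|𝓛⟩` is a `+1` eigenstate of all the stabilizers `S_j = D_{ℓ v_j}`, with
`ℓ = √(2π)` and `v_j` the columns of `L`; equivalently, all `S_j` have expectation `1`. -/
def IsLatticeState (L : Matrix (Fin M ⊕ Fin M) (Fin (2 * M)) ℝ) (χ : CharFn (Fin M)) : Prop :=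
  IsState χ ∧ ∀ j, χ (-(√(2 * Real.pi) • fun a => L a j)) = 1

/-- Syndromes of `M`-mode lattice states: vectors of `2M` real numbers modulo `√(2π)`. -/
abbrev Syndrome (M : ℕ) := Fin (2 * M) → AddCircle √(2 * Real.pi)

/-- The joint measurement of the (commuting) stabilizers of a lattice. The outcome `s` means that
`S_j` has the eigenvalue `exp (-i ℓ s_j)`; hence `∏ j, exp (-i ℓ k_j s_j)` has the expectation of
`S_1 ^ k_1 ⋯ S_{2M} ^ k_{2M} = exp (-(i/2) ∑_{j<l} k_j k_l ω(ℓ v_j, ℓ v_l)) D_{ℓ L k}`, for all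
integers `k_j`, which determines the outcome distribution. -/
def IsStabilizerMeasurement (L : Matrix (Fin M ⊕ Fin M) (Fin (2 * M)) ℝ)
    (P : Measurement (Fin M) (Syndrome M)) : Prop :=
  ∀ χ : CharFn (Fin M), IsPositive χ → ∀ k : Fin (2 * M) → ℤ,
    (P.rule χ).integral (fun s => ∏ j, fourier (-k j) (s j)) (ContinuousLinearMap.mul ℝ ℂ) =
      Complex.exp (-(Complex.I / 2) * ((∑ j, ∑ l ∈ Finset.Ioi j, (k j : ℝ) * (k l : ℝ) *
        omega (√(2 * Real.pi) • fun a => L a j) (√(2 * Real.pi) • fun a => L a l) : ℝ) : ℂ)) *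
      χ (-(√(2 * Real.pi) • (L *ᵥ fun j => (k j : ℝ))))

/-- Lattice codes: the ancilla is prepared in a lattice state of the lattice generated by `L`,
and the syndrome is obtained by measuring the stabilizers of that lattice. -/
structure Code.IsLatticeCode (C : Code N M (Syndrome M))
    (L : Matrix (Fin M ⊕ Fin M) (Fin (2 * M)) ℝ) : Prop where
  generator : IsLatticeGenerator L
  state : IsLatticeState L C.ancilla
  stabilizer : IsStabilizerMeasurement L C.meas

end O2O

end

/-! Averaging over the noise multiplies a characteristic function by exp(-σ²|ζ|²/2), so after
decoding the encoding `S` survives only in the quadratic form |Sζ|², equivalently in the covariance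
S⁻¹S⁻ᵀ (`Code.decoded_apply`). If a local X = A ⊕ B carries this covariance to that of `tms G`, then
|(tms G) X ζ| = |S ζ|. The decoded states then correspond under ζ ↦ X ζ, and `B` is absorbed into
the ancilla and its measurement, `A` into the data and the estimator. The lattice claim needs only
that `B` preserves ω.

It remains to find `A`, `B` and `G` (`exists_localSum_mul_eq_tms`). This is the modewise
decomposition of a pure Gaussian state. The map S⁻ᵀ embeds the data and ancilla phase spaces as
mutual ω-complements U and V in Euclidean space, where ω(x, y) = ⟪x, J y⟫ and the inner product
restricts to the covariance. Spectral theory of the compression of J yields Williamson bases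
(`exists_normal_pair`, `IsNormalFamily.exists_extend`).

Purity is the identity J² = -1. For a Williamson pair (e, f) of U with symplectic eigenvalue ν, it
makes νe - Jf and νf + Je ω-orthogonal to U, hence elements of V; both have squared norm ν(ν² - 1).
So ν ≥ 1, and if ν > 1 they rescale to a Williamson pair of V with the same ν, correlated with (e,
f) only. The remaining modes of V are uncorrelated with U and have eigenvalue 1
(`exists_modewise_normal_form`). The resulting Gram matrix is that of two-mode squeezers with 2G - 1
= ν. -/

noncomputable section

namespace O2O

/-! ### Williamson bases and the modewise normal form -/

section NormalForm

variable {H : Type*} [NormedAddCommGroup H] [InnerProductSpace ℝ H]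

local notation "⟪" x "," y "⟫" => inner ℝ x y

/-- A nonzero subspace on which the alternating form `⟪x, J y⟫` is nondegenerate contains a pair
that brings both this form and the inner product into normal form. -/
theorem exists_normal_pair (J : H →ₗ[ℝ] H) (hJ : ∀ x y, ⟪J x, y⟫ = -⟪x, J y⟫)
    (W : Submodule ℝ H) [FiniteDimensional ℝ W] (hW : W ≠ ⊥)
    (hnd : ∀ x ∈ W, (∀ y ∈ W, ⟪y, J x⟫ = 0) → x = 0) :
    ∃ e ∈ W, ∃ f ∈ W, ∃ ν : ℝ, 0 < ν ∧ ⟪e, J f⟫ = 1 ∧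
      (∀ x ∈ W, ⟪x, e⟫ = ν * ⟪x, J f⟫) ∧ (∀ x ∈ W, ⟪x, f⟫ = -(ν * ⟪x, J e⟫)) := by
  -- The compression of `J` to `W` is skew, so its square is symmetric and has an eigenvector `v`;
  -- the pair is made of multiples of `v` and `T v`.
  let T : W →ₗ[ℝ] W := W.orthogonalProjectionOnto.toLinearMap ∘ₗ J ∘ₗ W.subtype
  have hT : ∀ x y : W, ⟪x, T y⟫ = ⟪(x : H), J y⟫ := fun x y =>
    Submodule.inner_orthogonalProjectionOnto_eq_of_mem_left x (J y)
  have hskew : ∀ x y : W, ⟪T x, y⟫ = -⟪x, T y⟫ := fun x y => by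
    rw [real_inner_comm, hT, hT, ← hJ, real_inner_comm]
  have hsymm : (T ∘ₗ T).IsSymmetric := fun x y => by
    simp [hskew]
  have hnt : Nontrivial W := Submodule.nontrivial_iff_ne_bot.2 hW
  obtain ⟨c, hc⟩ : ∃ c, Module.End.HasEigenvalue (T ∘ₗ T) c := by
    by_contra! h
    exact not_subsingleton W (hsymm.subsingleton_of_no_eigenvalue_finiteDimensional
      fun c => not_not.1 (h c))
  obtain ⟨v, hv⟩ := hc.exists_hasEigenvector
  have hTv : T (T v) = c • v := hv.apply_eq_smul
  have hTv0 : T v ≠ 0 := by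
    intro h
    refine hv.2 (Subtype.ext (hnd v v.2 fun y hy => ?_))
    rw [← hT ⟨y, hy⟩ v, h, inner_zero_right]
  have hvv : 0 < ⟪v, v⟫ := real_inner_self_pos.2 hv.2
  have hc0 : 0 < -c := by
    have h1 : ⟪T v, T v⟫ = -c * ⟪v, v⟫ := by rw [hskew, hTv, inner_smul_right]; ring
    have h2 : 0 < ⟪T v, T v⟫ := real_inner_self_pos.2 hTv0
    rw [h1] at h2
    exact (pos_iff_pos_of_mul_pos h2).2 hvv
  obtain ⟨μ, hμ, hμc⟩ : ∃ μ : ℝ, 0 < μ ∧ c = -(μ * μ) :=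
    ⟨√(-c), Real.sqrt_pos.2 hc0, by rw [Real.mul_self_sqrt hc0.le]; ring⟩
  -- With e = a v and f = -(a/μ) T v one gets T f = aμ v; this choice of `a` then makes ω(e, f) = 1,
  -- and the symplectic eigenvalue is 1/μ.
  obtain ⟨a, ha, haa⟩ : ∃ a : ℝ, 0 < a ∧ a * a * (μ * ⟪v, v⟫) = 1 :=
    ⟨√(μ * ⟪v, v⟫)⁻¹, by positivity, by
      rw [Real.mul_self_sqrt (by positivity), inv_mul_cancel₀ (by positivity)]⟩
  have hf : T ((-(a / μ)) • T v) = (a * μ) • v := by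
    rw [map_smul, hTv, smul_smul, hμc]
    congr 1
    field_simp
  refine ⟨(a • v : W), (a • v : W).2, ((-(a / μ)) • T v : W), ((-(a / μ)) • T v : W).2, μ⁻¹,
    by positivity, ?_, fun x hx => ?_, fun x hx => ?_⟩
  · rw [← hT, hf, inner_smul_left, inner_smul_right, ← haa]
    simp only [conj_trivial]
    ring
  · rw [← hT ⟨x, hx⟩, hf, inner_smul_right]
    change ⟪(⟨x, hx⟩ : W), a • v⟫ = _
    rw [inner_smul_right]
    field_simp
  · rw [← hT ⟨x, hx⟩, map_smul, inner_smul_right]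
    change ⟪(⟨x, hx⟩ : W), (-(a / μ)) • T v⟫ = _
    rw [inner_smul_right]
    field_simp

/-- The pairs `(e i, f i)`, `i ∈ s`, in `U` are a symplectic family for the form `⟪x, J y⟫`, and the
inner product of `U` is diagonal on them with entries `ν i`. -/
structure IsNormalFamily {ι : Type*} [DecidableEq ι] (J : H →ₗ[ℝ] H) (U : Submodule ℝ H)
    (s : Finset ι) (e f : ι → H) (ν : ι → ℝ) : Prop where
  e_mem : ∀ i ∈ s, e i ∈ U
  f_mem : ∀ i ∈ s, f i ∈ U
  pos : ∀ i ∈ s, 0 < ν i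
  inner_e : ∀ i ∈ s, ∀ x ∈ U, ⟪x, e i⟫ = ν i * ⟪x, J (f i)⟫
  inner_f : ∀ i ∈ s, ∀ x ∈ U, ⟪x, f i⟫ = -(ν i * ⟪x, J (e i)⟫)
  ee : ∀ i ∈ s, ∀ j ∈ s, ⟪e i, J (e j)⟫ = 0
  ff : ∀ i ∈ s, ∀ j ∈ s, ⟪f i, J (f j)⟫ = 0
  ef : ∀ i ∈ s, ∀ j ∈ s, ⟪e i, J (f j)⟫ = if i = j then 1 else 0

variable {ι : Type*} [DecidableEq ι]

/-- A vector of `U` minus its component along a normal family. -/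
theorem IsNormalFamily.sub_sum_orthogonal {J : H →ₗ[ℝ] H} (hJ : ∀ x y, ⟪J x, y⟫ = -⟪x, J y⟫)
    {U : Submodule ℝ H} {s : Finset ι} {e f : ι → H} {ν : ι → ℝ}
    (h : IsNormalFamily J U s e f ν) (x : H) :
    ∀ i ∈ s,
      ⟪e i, J (x - ∑ k ∈ s, (⟪x, J (f k)⟫ • e k - ⟪x, J (e k)⟫ • f k))⟫ = 0 ∧
      ⟪f i, J (x - ∑ k ∈ s, (⟪x, J (f k)⟫ • e k - ⟪x, J (e k)⟫ • f k))⟫ = 0 := by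
  intro i hi
  have hfe : ∀ k ∈ s, ⟪f i, J (e k)⟫ = -(if k = i then 1 else 0) := fun k hk => by
    rw [← h.ef k hk i hi, ← hJ, real_inner_comm]
  constructor
  · rw [map_sub, inner_sub_right, map_sum, inner_sum, Finset.sum_eq_single_of_mem i hi]
    · rw [map_sub, map_smul, map_smul, inner_sub_right, inner_smul_right, inner_smul_right,
        h.ee i hi i hi, h.ef i hi i hi, if_pos rfl, ← real_inner_comm, hJ]
      ring
    · intro k hk hki
      rw [map_sub, map_smul, map_smul, inner_sub_right, inner_smul_right, inner_smul_right,
        h.ee i hi k hk, h.ef i hi k hk, if_neg (Ne.symm hki)]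
      ring
  · rw [map_sub, inner_sub_right, map_sum, inner_sum, Finset.sum_eq_single_of_mem i hi]
    · rw [map_sub, map_smul, map_smul, inner_sub_right, inner_smul_right, inner_smul_right,
        h.ff i hi i hi, hfe i hi, if_pos rfl, ← real_inner_comm, hJ]
      ring
    · intro k hk hki
      rw [map_sub, map_smul, map_smul, inner_sub_right, inner_smul_right, inner_smul_right,
        h.ff i hi k hk, hfe k hk, if_neg hki]
      ring

/-- Extension of a normal family by one pair. -/
theorem IsNormalFamily.exists_insert {J : H →ₗ[ℝ] H} (hJ : ∀ x y, ⟪J x, y⟫ = -⟪x, J y⟫)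
    {U : Submodule ℝ H} [FiniteDimensional ℝ U]
    (hnd : ∀ x ∈ U, (∀ y ∈ U, ⟪y, J x⟫ = 0) → x = 0)
    {s : Finset ι} {e f : ι → H} {ν : ι → ℝ} (h : IsNormalFamily J U s e f ν)
    (hs : 2 * s.card < Module.finrank ℝ U) {i₀ : ι} (hi₀ : i₀ ∉ s) :
    ∃ e' f' ν', IsNormalFamily J U (insert i₀ s) e' f' ν' ∧
      ∀ i ∈ s, e' i = e i ∧ f' i = f i ∧ ν' i = ν i := by
  -- The kernel is the ω-complement of the family in `U`. It is cut out by 2|s| functionals, so the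
  -- dimension bound makes it nonzero.
  let c : U →ₗ[ℝ] (s × Fin 2 → ℝ) := LinearMap.pi fun p =>
    if p.2 = 0 then (innerₛₗ ℝ (e p.1)) ∘ₗ J ∘ₗ U.subtype else (innerₛₗ ℝ (f p.1)) ∘ₗ J ∘ₗ U.subtype
  let W : Submodule ℝ H := (LinearMap.ker c).map U.subtype
  have hWU : W ≤ U := by
    rintro _ ⟨x, -, rfl⟩
    exact x.2
  have hmem : ∀ x ∈ U, (∀ i ∈ s, ⟪e i, J x⟫ = 0 ∧ ⟪f i, J x⟫ = 0) → x ∈ W := by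
    intro x hx hx'
    refine ⟨⟨x, hx⟩, ?_, rfl⟩
    refine LinearMap.mem_ker.2 (funext fun p => ?_)
    by_cases hp : p.2 = 0
    · simpa [c, hp] using (hx' p.1 p.1.2).1
    · simpa [c, hp] using (hx' p.1 p.1.2).2
  have hWe : ∀ x ∈ W, ∀ i ∈ s, ⟪e i, J x⟫ = 0 := by
    rintro _ ⟨x, hx, rfl⟩ i hi
    simpa [c] using congrFun (LinearMap.mem_ker.1 hx) (⟨i, hi⟩, 0)
  have hWf : ∀ x ∈ W, ∀ i ∈ s, ⟪f i, J x⟫ = 0 := by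
    rintro _ ⟨x, hx, rfl⟩ i hi
    simpa [c] using congrFun (LinearMap.mem_ker.1 hx) (⟨i, hi⟩, 1)
  have hWfin : FiniteDimensional ℝ W := Submodule.finiteDimensional_of_le hWU
  have hW : W ≠ ⊥ := by
    have hk : LinearMap.ker c ≠ ⊥ := LinearMap.ker_ne_bot_of_finrank_lt (by simpa [mul_comm] using hs)
    intro h0
    exact hk (Submodule.map_injective_of_injective U.injective_subtype
      (h0.trans (Submodule.map_bot _).symm))
  have hcomm : ∀ x y, ⟪x, J y⟫ = 0 → ⟪y, J x⟫ = 0 := fun x y hxy => by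
    rw [← real_inner_comm, hJ, hxy, neg_zero]
  have hdec : ∀ x ∈ U, x - ∑ k ∈ s, (⟪x, J (f k)⟫ • e k - ⟪x, J (e k)⟫ • f k) ∈ W := by
    intro x hx
    refine hmem _ (U.sub_mem hx (U.sum_mem fun k hk => U.sub_mem (U.smul_mem _ (h.e_mem k hk))
      (U.smul_mem _ (h.f_mem k hk)))) (h.sub_sum_orthogonal hJ x)
  -- `U` is the sum of `W` and the span of the family, so orthogonality to `U` can be tested on
  -- these two separately.
  have hred : ∀ v : H, (∀ x ∈ W, ⟪x, v⟫ = 0) → (∀ i ∈ s, ⟪e i, v⟫ = 0 ∧ ⟪f i, v⟫ = 0) →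
      ∀ x ∈ U, ⟪x, v⟫ = 0 := by
    intro v h1 h2 x hx
    have := h1 _ (hdec x hx)
    rw [inner_sub_left, sum_inner, Finset.sum_eq_zero, sub_zero] at this
    · exact this
    · intro k hk
      simp [inner_sub_left, inner_smul_left, h2 k hk]
  obtain ⟨a, haW, b, hbW, μ, hμ, hab, ha, hb⟩ := exists_normal_pair J hJ W hW (by
    intro x hx hx0
    exact hnd x (hWU hx) (hred _ hx0 fun i hi => ⟨hWe x hx i hi, hWf x hx i hi⟩))
  -- On `U` the inner product with one vector of a pair is a multiple of ω with its partner, so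
  -- ω-orthogonality to the family implies orthogonality.
  have horth : ∀ x ∈ W, ∀ i ∈ s, ⟪e i, x⟫ = 0 ∧ ⟪f i, x⟫ = 0 := fun x hx i hi => by
    rw [real_inner_comm, h.inner_e i hi x (hWU hx), real_inner_comm x (f i),
      h.inner_f i hi x (hWU hx), hcomm _ _ (hWe x hx i hi), hcomm _ _ (hWf x hx i hi)]
    simp
  have hne : ∀ i ∈ s, i ≠ i₀ := fun i hi h' => hi₀ (h' ▸ hi)
  refine ⟨Function.update e i₀ a, Function.update f i₀ b, Function.update ν i₀ μ, ?_, fun i hi =>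
    by simp [hne i hi]⟩
  have hself : ∀ x, ⟪x, J x⟫ = 0 := fun x => by
    have := hJ x x
    rw [real_inner_comm] at this
    linarith
  refine ⟨?_, ?_, ?_, ?_, ?_, ?_, ?_, ?_⟩
  · rw [Finset.forall_mem_insert]
    exact ⟨by simpa using hWU haW, fun i hi => by simpa [hne i hi] using h.e_mem i hi⟩
  · rw [Finset.forall_mem_insert]
    exact ⟨by simpa using hWU hbW, fun i hi => by simpa [hne i hi] using h.f_mem i hi⟩
  · rw [Finset.forall_mem_insert]
    exact ⟨by simpa using hμ, fun i hi => by simpa [hne i hi] using h.pos i hi⟩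
  · rw [Finset.forall_mem_insert]
    refine ⟨fun x hx => ?_, fun i hi => by simpa [hne i hi] using h.inner_e i hi⟩
    have := hred (a - μ • J b) (fun y hy => by
      rw [inner_sub_right, inner_smul_right, ha y hy, sub_self]) (fun i hi => by
      simp [inner_sub_right, inner_smul_right, horth a haW i hi, hWe b hbW i hi,
        hWf b hbW i hi]) x hx
    rw [inner_sub_right, inner_smul_right, sub_eq_zero] at this
    simpa using this
  · rw [Finset.forall_mem_insert]
    refine ⟨fun x hx => ?_, fun i hi => by simpa [hne i hi] using h.inner_f i hi⟩
    have := hred (b + μ • J a) (fun y hy => by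
      rw [inner_add_right, inner_smul_right, hb y hy, neg_add_cancel]) (fun i hi => by
      simp [inner_add_right, inner_smul_right, horth b hbW i hi, hWe a haW i hi,
        hWf a haW i hi]) x hx
    rw [inner_add_right, inner_smul_right, add_eq_zero_iff_eq_neg] at this
    simpa using this
  · simp only [Finset.forall_mem_insert]
    exact ⟨⟨by simp [hself], fun j hj => by simpa [hne j hj] using hcomm _ _ (hWe a haW j hj)⟩,
      fun i hi => ⟨by simpa [hne i hi] using hWe a haW i hi,
        fun j hj => by simpa [hne i hi, hne j hj] using h.ee i hi j hj⟩⟩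
  · simp only [Finset.forall_mem_insert]
    exact ⟨⟨by simp [hself], fun j hj => by simpa [hne j hj] using hcomm _ _ (hWf b hbW j hj)⟩,
      fun i hi => ⟨by simpa [hne i hi] using hWf b hbW i hi,
        fun j hj => by simpa [hne i hi, hne j hj] using h.ff i hi j hj⟩⟩
  · simp only [Finset.forall_mem_insert]
    exact ⟨⟨by simpa using hab, fun j hj => by
        simpa [hne j hj, (hne j hj).symm] using hcomm _ _ (hWf a haW j hj)⟩,
      fun i hi => ⟨by simpa [hne i hi] using hWe b hbW i hi,
        fun j hj => by simpa [hne i hi, hne j hj] using h.ef i hi j hj⟩⟩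

/-- Williamson normal form, with a prescribed part of the family. -/
theorem IsNormalFamily.exists_extend [Fintype ι] {J : H →ₗ[ℝ] H}
    (hJ : ∀ x y, ⟪J x, y⟫ = -⟪x, J y⟫) {U : Submodule ℝ H} [FiniteDimensional ℝ U]
    (hnd : ∀ x ∈ U, (∀ y ∈ U, ⟪y, J x⟫ = 0) → x = 0)
    (hU : Module.finrank ℝ U = 2 * Fintype.card ι)
    {s : Finset ι} {e f : ι → H} {ν : ι → ℝ} (h : IsNormalFamily J U s e f ν) :
    ∃ e' f' ν', IsNormalFamily J U (Finset.univ : Finset ι) e' f' ν' ∧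
      ∀ i ∈ s, e' i = e i ∧ f' i = f i ∧ ν' i = ν i := by
  obtain ⟨n, hn⟩ : ∃ n, s.card + n = Fintype.card ι :=
    ⟨_, Nat.add_sub_cancel' s.card_le_univ⟩
  induction n generalizing s e f ν with
  | zero =>
    obtain rfl : s = Finset.univ := (Finset.card_eq_iff_eq_univ s).1 hn
    exact ⟨e, f, ν, h, fun _ _ => ⟨rfl, rfl, rfl⟩⟩
  | succ n ih =>
    obtain ⟨i₀, hi₀⟩ : ∃ i₀, i₀ ∉ s := by
      by_contra! h'
      rw [Finset.eq_univ_of_forall h', Finset.card_univ] at hn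
      omega
    obtain ⟨e₁, f₁, ν₁, h₁, hs₁⟩ := h.exists_insert hJ hnd (by omega) hi₀
    obtain ⟨e₂, f₂, ν₂, h₂, hs₂⟩ := ih h₁ (by rw [Finset.card_insert_of_notMem hi₀]; omega)
    refine ⟨e₂, f₂, ν₂, h₂, fun i hi => ?_⟩
    obtain ⟨h3, h4, h5⟩ := hs₂ i (Finset.mem_insert_of_mem hi)
    rw [h3, h4, h5]
    exact hs₁ i hi

/-! ### Gram matrix of a normal family -/

section Gram

variable {J : H →ₗ[ℝ] H} {U : Submodule ℝ H} {s : Finset ι} {e f : ι → H} {ν : ι → ℝ}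

theorem IsNormalFamily.inner_f_J_e (h : IsNormalFamily J U s e f ν)
    (hJ : ∀ x y, ⟪J x, y⟫ = -⟪x, J y⟫) {i j : ι} (hi : i ∈ s) (hj : j ∈ s) :
    ⟪f i, J (e j)⟫ = if i = j then -1 else 0 := by
  rw [← neg_neg ⟪f i, _⟫, ← hJ, real_inner_comm, h.ef j hj i hi, apply_ite Neg.neg, neg_zero]
  simp only [eq_comm]

theorem IsNormalFamily.inner_e_e (h : IsNormalFamily J U s e f ν) {i j : ι} (hi : i ∈ s)
    (hj : j ∈ s) : ⟪e i, e j⟫ = if i = j then ν i else 0 := by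
  rw [h.inner_e j hj _ (h.e_mem i hi), h.ef i hi j hj]
  split_ifs with hij <;> simp [hij]

theorem IsNormalFamily.inner_f_f (h : IsNormalFamily J U s e f ν)
    (hJ : ∀ x y, ⟪J x, y⟫ = -⟪x, J y⟫) {i j : ι} (hi : i ∈ s) (hj : j ∈ s) :
    ⟪f i, f j⟫ = if i = j then ν i else 0 := by
  rw [h.inner_f j hj _ (h.f_mem i hi), h.inner_f_J_e hJ hi hj]
  split_ifs with hij <;> simp [hij]

theorem IsNormalFamily.inner_e_f (h : IsNormalFamily J U s e f ν) {i j : ι} (hi : i ∈ s)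
    (hj : j ∈ s) : ⟪e i, f j⟫ = 0 := by
  rw [h.inner_f j hj _ (h.e_mem i hi), h.ee i hi j hj, mul_zero, neg_zero]

theorem IsNormalFamily.inner_f_e (h : IsNormalFamily J U s e f ν) {i j : ι} (hi : i ∈ s)
    (hj : j ∈ s) : ⟪f i, e j⟫ = 0 := by
  rw [real_inner_comm, h.inner_e_f hj hi]

/-- The Gram matrix is diagonal with positive entries, so the vectors are independent and a
dimension count finishes. -/
theorem IsNormalFamily.span_eq [Fintype ι] (hJ : ∀ x y, ⟪J x, y⟫ = -⟪x, J y⟫)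
    [FiniteDimensional ℝ U] (hU : Module.finrank ℝ U = 2 * Fintype.card ι)
    (h : IsNormalFamily J U Finset.univ e f ν) :
    Submodule.span ℝ (Set.range (Sum.elim e f)) = U := by
  have hm : ∀ i, i ∈ (Finset.univ : Finset ι) := Finset.mem_univ
  have hlin : LinearIndependent ℝ (Sum.elim e f) := by
    refine linearIndependent_of_ne_zero_of_inner_eq_zero (𝕜 := ℝ) ?_ ?_
    · rintro (i | i) h0
      · have := h.inner_e_e (hm i) (hm i)
        simp only [Sum.elim_inl] at h0
        simp [h0] at this
        exact (h.pos i (hm i)).ne this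
      · have := h.inner_f_f hJ (hm i) (hm i)
        simp only [Sum.elim_inr] at h0
        simp [h0] at this
        exact (h.pos i (hm i)).ne this
    · rintro (i | i) (j | j) hij
      · have : i ≠ j := fun h' => hij (h' ▸ rfl)
        simpa [this] using h.inner_e_e (hm i) (hm j)
      · exact h.inner_e_f (hm i) (hm j)
      · exact h.inner_f_e (hm i) (hm j)
      · have : i ≠ j := fun h' => hij (h' ▸ rfl)
        simpa [this] using h.inner_f_f hJ (hm i) (hm j)
  refine Submodule.eq_of_le_of_finrank_eq (Submodule.span_le.2 ?_) ?_
  · rintro _ ⟨i | i, rfl⟩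
    · exact h.e_mem i (hm i)
    · exact h.f_mem i (hm i)
  · rw [finrank_span_eq_card hlin, hU, Fintype.card_sum, two_mul]

theorem IsNormalFamily.inner_eq_zero [Fintype ι] (hJ : ∀ x y, ⟪J x, y⟫ = -⟪x, J y⟫)
    [FiniteDimensional ℝ U] (hU : Module.finrank ℝ U = 2 * Fintype.card ι)
    (h : IsNormalFamily J U Finset.univ e f ν) {v : H} (he : ∀ i, ⟪e i, v⟫ = 0)
    (hf : ∀ i, ⟪f i, v⟫ = 0) {x : H} (hx : x ∈ U) : ⟪x, v⟫ = 0 := by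
  rw [← h.span_eq hJ hU] at hx
  induction hx using Submodule.span_induction with
  | mem x hx =>
    obtain ⟨i | i, rfl⟩ := hx
    · exact he i
    · exact hf i
  | zero => exact inner_zero_left _
  | add x y _ _ hx hy => rw [inner_add_left, hx, hy, add_zero]
  | smul a x _ hx => rw [inner_smul_left, hx, mul_zero]

end Gram

/-- The modewise normal form of a pair of complementary symplectic subspaces `U`, `V` with respect
to an orthogonal complex structure `J`: there are Williamson bases of `U` and `V` with matching
symplectic eigenvalues, each mode of `U` being correlated with one mode of `V` only. -/
theorem exists_modewise_normal_form {κ : Type*} [DecidableEq κ] [Fintype ι] [Fintype κ]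
    {J : H →ₗ[ℝ] H} (hJ : ∀ x y, ⟪J x, y⟫ = -⟪x, J y⟫) (hJJ : ∀ x, J (J x) = -x)
    {U V : Submodule ℝ H} [FiniteDimensional ℝ U] [FiniteDimensional ℝ V]
    (hU : ∀ x, x ∈ U ↔ ∀ y ∈ V, ⟪y, J x⟫ = 0) (hV : ∀ x, x ∈ V ↔ ∀ y ∈ U, ⟪y, J x⟫ = 0)
    (hUV : Disjoint U V)
    (hUdim : Module.finrank ℝ U = 2 * Fintype.card ι)
    (hVdim : Module.finrank ℝ V = 2 * Fintype.card κ) (φ : ι ↪ κ) :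
    ∃ (e f : ι → H) (ν : ι → ℝ) (e' f' : κ → H) (μ : κ → ℝ),
      IsNormalFamily J U Finset.univ e f ν ∧ IsNormalFamily J V Finset.univ e' f' μ ∧
      (∀ i, 1 ≤ ν i) ∧ (∀ i, μ (φ i) = ν i) ∧ (∀ a, (∀ i, φ i ≠ a) → μ a = 1) ∧
      (∀ i a, ⟪e i, e' a⟫ = if φ i = a then -√(ν i ^ 2 - 1) else 0) ∧
      (∀ i a, ⟪f i, f' a⟫ = if φ i = a then √(ν i ^ 2 - 1) else 0) ∧
      (∀ i a, ⟪e i, f' a⟫ = 0) ∧ (∀ i a, ⟪f i, e' a⟫ = 0) := by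
  have hndU : ∀ x ∈ U, (∀ y ∈ U, ⟪y, J x⟫ = 0) → x = 0 := fun x hx hx' =>
    Submodule.disjoint_def.1 hUV x hx ((hV x).2 hx')
  have hndV : ∀ x ∈ V, (∀ y ∈ V, ⟪y, J x⟫ = 0) → x = 0 := fun x hx hx' =>
    Submodule.disjoint_def.1 hUV x ((hU x).2 hx') hx
  have hemp : IsNormalFamily J U (∅ : Finset ι) 0 0 0 := by
    constructor <;> simp
  obtain ⟨e, f, ν, h, -⟩ := hemp.exists_extend hJ hndU hUdim
  have hm : ∀ i, i ∈ (Finset.univ : Finset ι) := Finset.mem_univ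
  -- the vectors of `V` correlated with `e i` and `f i`
  let u : ι → H := fun i => ν i • e i - J (f i)
  let w : ι → H := fun i => ν i • f i + J (e i)
  -- Through J² = -1, the relations `inner_f` and `inner_e` become the ω-orthogonality of `u i` and
  -- `w i` to `U`.
  have hJu : ∀ i, J (u i) = ν i • J (e i) + f i := fun i => by simp [u, hJJ]
  have hJw : ∀ i, J (w i) = ν i • J (f i) - e i := fun i => by simp [w, hJJ, sub_eq_add_neg]
  have huV : ∀ i, u i ∈ V := fun i => (hV _).2 fun y hy => by
    rw [hJu, inner_add_right, inner_smul_right, h.inner_f i (hm i) y hy, add_neg_cancel]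
  have hwV : ∀ i, w i ∈ V := fun i => (hV _).2 fun y hy => by
    rw [hJw, inner_sub_right, inner_smul_right, h.inner_e i (hm i) y hy, sub_self]
  have hUJ : ∀ x ∈ V, ∀ y ∈ U, ⟪x, J y⟫ = 0 := fun x hx y hy => (hU y).1 hy x hx
  have hVJ : ∀ x ∈ U, ∀ y ∈ V, ⟪x, J y⟫ = 0 := fun x hx y hy => (hV y).1 hy x hx
  have hVu : ∀ x ∈ V, ∀ i, ⟪x, u i⟫ = ν i * ⟪x, e i⟫ := fun x hx i => by
    rw [inner_sub_right, inner_smul_right, hUJ x hx _ (h.f_mem i (hm i)), sub_zero]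
  have hVw : ∀ x ∈ V, ∀ i, ⟪x, w i⟫ = ν i * ⟪x, f i⟫ := fun x hx i => by
    rw [inner_add_right, inner_smul_right, hUJ x hx _ (h.e_mem i (hm i)), add_zero]
  have hVJu : ∀ x ∈ V, ∀ i, ⟪x, J (u i)⟫ = ⟪x, f i⟫ := fun x hx i => by
    rw [hJu, inner_add_right, inner_smul_right, hUJ x hx _ (h.e_mem i (hm i)), mul_zero, zero_add]
  have hVJw : ∀ x ∈ V, ∀ i, ⟪x, J (w i)⟫ = -⟪x, e i⟫ := fun x hx i => by
    rw [hJw, inner_sub_right, inner_smul_right, hUJ x hx _ (h.f_mem i (hm i)), mul_zero, zero_sub]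
  have hue : ∀ i j, ⟪u i, e j⟫ = if i = j then ν i ^ 2 - 1 else 0 := fun i j => by
    rw [inner_sub_left, inner_smul_left, h.inner_e_e (hm i) (hm j), real_inner_comm,
      h.ef j (hm j) i (hm i)]
    by_cases hij : i = j
    · simp [hij]; ring
    · simp [hij, Ne.symm hij]
  have huf : ∀ i j, ⟪u i, f j⟫ = 0 := fun i j => by
    rw [inner_sub_left, inner_smul_left, h.inner_e_f (hm i) (hm j), hJ,
      h.ff i (hm i) j (hm j)]
    simp
  have hwe : ∀ i j, ⟪w i, e j⟫ = 0 := fun i j => by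
    rw [inner_add_left, inner_smul_left, h.inner_f_e (hm i) (hm j), hJ,
      h.ee i (hm i) j (hm j)]
    simp
  have hwf : ∀ i j, ⟪w i, f j⟫ = if i = j then ν i ^ 2 - 1 else 0 := fun i j => by
    rw [inner_add_left, inner_smul_left, h.inner_f_f hJ (hm i) (hm j), hJ,
      h.ef i (hm i) j (hm j)]
    by_cases hij : i = j
    · simp [hij]; ring
    · simp [hij]
  have huu : ∀ i, ⟪u i, u i⟫ = ν i * (ν i ^ 2 - 1) := fun i => by
    rw [hVu _ (huV i), hue, if_pos rfl]
  have hww : ∀ i, ⟪w i, w i⟫ = ν i * (ν i ^ 2 - 1) := fun i => by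
    rw [hVw _ (hwV i), hwf, if_pos rfl]
  have hν0 : ∀ i, 0 < ν i := fun i => h.pos i (hm i)
  -- The uncertainty relation, read off from 0 ≤ |u i|² = ν(ν² - 1).
  have hν1 : ∀ i, 0 ≤ ν i ^ 2 - 1 := fun i => by
    have := huu i ▸ real_inner_self_nonneg (x := u i)
    exact nonneg_of_mul_nonneg_right this (hν0 i)
  have hν : ∀ i, 1 ≤ ν i := fun i => by nlinarith [hν1 i, hν0 i]
  let r : ι → ℝ := fun i => √(ν i ^ 2 - 1)
  have hrr : ∀ i, r i * r i = ν i ^ 2 - 1 := fun i => Real.mul_self_sqrt (hν1 i)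
  have hr : ∀ i, 1 < ν i → r i ≠ 0 := fun i hi => (Real.sqrt_pos.2 (by nlinarith)).ne'
  have hr0 : ∀ i, ν i = 1 → r i = 0 := fun i hi => by simp [r, hi]
  -- the normal family that they form
  let s : Finset κ := (Finset.univ.filter fun i => 1 < ν i).map φ
  have hs : ∀ p : κ → Prop, (∀ a ∈ s, p a) ↔ ∀ i, 1 < ν i → p (φ i) := fun p => by
    simp [s]
  -- The minus sign gives ω(e₀, f₀) = +1 and the correlation signs of an inverse squeezer. The value
  -- 0 off the range of `φ` is irrelevant, since only indices in `s` are used.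
  let e₀ : κ → H := Function.extend φ (fun i => -(r i)⁻¹ • u i) 0
  let f₀ : κ → H := Function.extend φ (fun i => (r i)⁻¹ • w i) 0
  let μ₀ : κ → ℝ := Function.extend φ ν 0
  have he₀ : ∀ i, e₀ (φ i) = -(r i)⁻¹ • u i := fun i => φ.injective.extend_apply _ _ i
  have hf₀ : ∀ i, f₀ (φ i) = (r i)⁻¹ • w i := fun i => φ.injective.extend_apply _ _ i
  have hμ₀ : ∀ i, μ₀ (φ i) = ν i := fun i => φ.injective.extend_apply _ _ i
  have h₀ : IsNormalFamily J V s e₀ f₀ μ₀ := by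
    refine ⟨?_, ?_, ?_, ?_, ?_, ?_, ?_, ?_⟩ <;>
      simp only [hs, he₀, hf₀, hμ₀, map_smul, inner_smul_left, inner_smul_right, conj_trivial]
    · exact fun i _ => V.smul_mem _ (huV i)
    · exact fun i _ => V.smul_mem _ (hwV i)
    · exact fun i _ => hν0 i
    · intro i _ x hx
      rw [hVu x hx, hVJw x hx]; ring
    · intro i _ x hx
      rw [hVw x hx, hVJu x hx]; ring
    · intro i _ j _
      rw [hVJu _ (huV i), huf, mul_zero, mul_zero]
    · intro i _ j _
      rw [hVJw _ (hwV i), hwe, neg_zero, mul_zero, mul_zero]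
    · intro i hi j _
      rw [hVJw _ (huV i), hue]
      simp only [φ.injective.eq_iff]
      by_cases hij : i = j
      · subst hij
        rw [if_pos rfl, if_pos rfl, ← hrr]
        field_simp [hr i hi]
      · simp [hij]
  obtain ⟨e', f', μ, h', hext⟩ := h₀.exists_extend hJ hndV hVdim
  have hm' : ∀ a, a ∈ (Finset.univ : Finset κ) := Finset.mem_univ
  have hmem_s : ∀ i, 1 < ν i → φ i ∈ s := fun i hi => by simp [s, hi]
  -- This persists for ν i = 1, where `huu` forces `u i = 0` and `r i` vanishes; hence the
  -- correlations `c1`–`c4` need no case distinction on ν.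
  have hue' : ∀ i, u i = -r i • e' (φ i) := fun i => by
    rcases (hν i).eq_or_lt with hi | hi
    · rw [hr0 i hi.symm, neg_zero, zero_smul, ← inner_self_eq_zero (𝕜 := ℝ), huu, ← hi]
      norm_num
    · rw [(hext _ (hmem_s i hi)).1, he₀, smul_smul, neg_mul_neg, mul_inv_cancel₀ (hr i hi),
        one_smul]
  have hwf' : ∀ i, w i = r i • f' (φ i) := fun i => by
    rcases (hν i).eq_or_lt with hi | hi
    · rw [hr0 i hi.symm, zero_smul, ← inner_self_eq_zero (𝕜 := ℝ), hww, ← hi]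
      norm_num
    · rw [(hext _ (hmem_s i hi)).2.1, hf₀, smul_smul, mul_inv_cancel₀ (hr i hi), one_smul]
  have hVe : ∀ x ∈ V, ∀ i, ⟪e i, x⟫ = -(r i * ⟪x, J (f' (φ i))⟫) := fun x hx i => by
    rw [real_inner_comm, ← neg_neg ⟪x, e i⟫, ← hVJw x hx, hwf', map_smul, inner_smul_right]
  have hVf : ∀ x ∈ V, ∀ i, ⟪f i, x⟫ = -(r i * ⟪x, J (e' (φ i))⟫) := fun x hx i => by
    rw [real_inner_comm, ← hVJu x hx, hue', map_smul, inner_smul_right, neg_mul]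
  have c1 : ∀ i a, ⟪e i, e' a⟫ = if φ i = a then -r i else 0 := fun i a => by
    rw [hVe _ (h'.e_mem a (hm' a)), h'.ef a (hm' a) _ (hm' _)]
    by_cases hia : φ i = a
    · simp [hia]
    · simp [hia, Ne.symm hia]
  have c2 : ∀ i a, ⟪f i, f' a⟫ = if φ i = a then r i else 0 := fun i a => by
    rw [hVf _ (h'.f_mem a (hm' a)), h'.inner_f_J_e hJ (hm' a) (hm' _)]
    by_cases hia : φ i = a
    · simp [hia]
    · simp [hia, Ne.symm hia]
  have c3 : ∀ i a, ⟪e i, f' a⟫ = 0 := fun i a => by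
    rw [hVe _ (h'.f_mem a (hm' a)), h'.ff a (hm' a) _ (hm' _), mul_zero, neg_zero]
  have c4 : ∀ i a, ⟪f i, e' a⟫ = 0 := fun i a => by
    rw [hVf _ (h'.e_mem a (hm' a)), h'.ee a (hm' a) _ (hm' _), mul_zero, neg_zero]
  -- The construction is now reversed: `z` lies in `U`, and is ω-orthogonal to `U` because `f' a` is
  -- uncorrelated with `U`. Hence z = 0, while ⟪z, e' a⟫ = μ² - 1.
  have hμ1 : ∀ a, a ∉ s → μ a = 1 := fun a ha => by
    let z : H := μ a • e' a - J (f' a)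
    have hJz : J z = μ a • J (e' a) + f' a := by simp [z, hJJ]
    have hzU : z ∈ U := (hU _).2 fun y hy => by
      rw [hJz, inner_add_right, inner_smul_right, h'.inner_f a (hm' a) y hy, add_neg_cancel]
    have hz0 : z = 0 := by
      refine hndU z hzU fun y hy => ?_
      rw [hJz, inner_add_right, inner_smul_right, hVJ y hy _ (h'.e_mem a (hm' a)), mul_zero,
        zero_add]
      refine h.inner_eq_zero hJ hUdim (fun i => c3 i a) (fun i => ?_) hy
      rw [c2]
      split_ifs with hia
      · refine hr0 i (le_antisymm (not_lt.1 fun hi => ha (hia ▸ hmem_s i hi)) (hν i))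
      · rfl
    have : ⟪z, e' a⟫ = μ a ^ 2 - 1 := by
      rw [inner_sub_left, inner_smul_left, h'.inner_e_e (hm' a) (hm' a), real_inner_comm,
        h'.ef a (hm' a) a (hm' a)]
      simp
      ring
    rw [hz0, inner_zero_left] at this
    nlinarith [h'.pos a (hm' a)]
  refine ⟨e, f, ν, e', f', μ, h, h', hν, fun i => ?_, fun a ha => hμ1 a ?_, c1, c2, c3, c4⟩
  -- If ν i = 1, then `φ i` was left out of `s`, and `hμ1` supplies the matching eigenvalue 1.
  · rcases (hν i).eq_or_lt with hi | hi
    · rw [← hi]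
      refine hμ1 _ fun hmem => ?_
      simp only [s, Finset.mem_map, Finset.mem_filter, Finset.mem_univ, true_and] at hmem
      obtain ⟨j, hj, hji⟩ := hmem
      rw [φ.injective hji, ← hi] at hj
      exact lt_irrefl _ hj
    · rw [(hext _ (hmem_s i hi)).2.2, hμ₀]
  · intro hmem
    obtain ⟨i, -, hi⟩ := Finset.mem_map.1 hmem
    exact ha i hi

end NormalForm


/-! ### Joint phase space and a row criterion for symplectic matrices -/

section Joint

variable {α β : Type*}

theorem joinPhase_fstPart_sndPart (ζ : Phase (α ⊕ β)) : joinPhase (fstPart ζ) (sndPart ζ) = ζ := by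
  ext ((i | i) | (i | i)) <;> rfl

theorem fstPart_joinPhase (a : Phase α) (b : Phase β) : fstPart (joinPhase a b) = a := by
  ext (i | i) <;> rfl

theorem sndPart_joinPhase (a : Phase α) (b : Phase β) : sndPart (joinPhase a b) = b := by
  ext (i | i) <;> rfl

/-- `joinPhase` as a linear map. -/
def joinLinear : Phase α × Phase β →ₗ[ℝ] Phase (α ⊕ β) where
  toFun p := joinPhase p.1 p.2
  map_add' _ _ := by ext ((i | i) | (i | i)) <;> rfl
  map_smul' _ _ := by ext ((i | i) | (i | i)) <;> rfl

theorem omega_joinPhase [Fintype α] [Fintype β] (a c : Phase α) (b d : Phase β) :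
    omega (joinPhase a b) (joinPhase c d) = omega a c + omega b d := by
  simp [omega, joinPhase, Fintype.sum_sum_type, Finset.sum_sub_distrib]
  ring

theorem omega_zero_left [Fintype α] (x : Phase α) : omega 0 x = 0 := by simp [omega]

theorem omega_zero_right [Fintype α] (x : Phase α) : omega x 0 = 0 := by simp [omega]

theorem omega_eq_zero [Fintype α] [DecidableEq α] {x : Phase α} (h : ∀ y, omega y x = 0) :
    x = 0 := by
  ext (i | i)
  · simpa [omega, Pi.single_apply] using h (Pi.single (Sum.inr i) 1)
  · simpa [omega, Pi.single_apply] using h (Pi.single (Sum.inl i) 1)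

theorem localSum_mulVec [Fintype α] [Fintype β] (A : Matrix (α ⊕ α) (α ⊕ α) ℝ)
    (B : Matrix (β ⊕ β) (β ⊕ β) ℝ) (a : Phase α) (b : Phase β) :
    localSum A B *ᵥ joinPhase a b = joinPhase (A *ᵥ a) (B *ᵥ b) := by
  ext ((i | i) | (i | i)) <;>
    simp [localSum, joinPhase, Matrix.mulVec, dotProduct, Fintype.sum_sum_type]

/-- The entries of R J Rᵀ are, up to sign, the values of ω on the rows; this turns a Williamson
basis into a symplectic matrix. -/
theorem mem_symplecticGroup_of_rows [Fintype α] [DecidableEq α] {R : Matrix (α ⊕ α) (α ⊕ α) ℝ}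
    (hee : ∀ i j, omega (R (Sum.inl i)) (R (Sum.inl j)) = 0)
    (hff : ∀ i j, omega (R (Sum.inr i)) (R (Sum.inr j)) = 0)
    (hef : ∀ i j, omega (R (Sum.inl i)) (R (Sum.inr j)) = if i = j then 1 else 0) :
    R ∈ Matrix.symplecticGroup α ℝ := by
  have key : ∀ a b, (R * Matrix.J α ℝ * Rᵀ) a b = -omega (R a) (R b) := fun a b => by
    rw [omega_eq, neg_neg, Matrix.mul_assoc]
    rfl
  have hfe : ∀ i j, omega (R (Sum.inr i)) (R (Sum.inl j)) = -if i = j then 1 else 0 := fun i j => by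
    simp only [eq_comm (a := i), ← hef j i, omega, ← Finset.sum_neg_distrib]
    exact Finset.sum_congr rfl fun _ _ => by ring
  rw [SymplecticGroup.mem_iff]
  ext (i | i) (j | j) <;> rw [key]
  · simp [hee, Matrix.J]
  · simp [hef, Matrix.J, Matrix.one_apply]
  · simp [hfe, Matrix.J, Matrix.one_apply]
  · simp [hff, Matrix.J]

end Joint

/-! ### Covariance of two-mode squeezers -/

section Squeezers

variable {N M : ℕ}

/-- Double-angle formulas: for √G = cosh r the entries are cosh 2r = 2G - 1 and ± sinh 2r, written
through 2G - 1 so as to match a symplectic eigenvalue. -/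
theorem tmsQuad_mul_self (hNM : N ≤ M) {e : ℝ} (he : e * e = 1) {G : Fin N → ℝ}
    (hG : ∀ i, 1 ≤ G i) :
    (tmsQuad e G : Matrix (Fin N ⊕ Fin M) (Fin N ⊕ Fin M) ℝ) * tmsQuad e G =
      Matrix.fromBlocks
        (Matrix.diagonal fun i => 2 * G i - 1)
        (Matrix.of fun i (a : Fin M) => if (i : ℕ) = a then e * √((2 * G i - 1) ^ 2 - 1) else 0)
        (Matrix.of fun (a : Fin M) i => if (i : ℕ) = a then e * √((2 * G i - 1) ^ 2 - 1) else 0)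
        (Matrix.diagonal fun a : Fin M => if h : (a : ℕ) < N then 2 * G ⟨a, h⟩ - 1 else 1) := by
  have h1 : ∀ i, √(G i) * √(G i) = G i := fun i => Real.mul_self_sqrt (by linarith [hG i])
  have h2 : ∀ i, e * √(G i - 1) * (e * √(G i - 1)) = G i - 1 := fun i => by
    rw [mul_mul_mul_comm, he, one_mul, Real.mul_self_sqrt (by linarith [hG i])]
  have h3 : ∀ i, √((2 * G i - 1) ^ 2 - 1) = 2 * (√(G i) * √(G i - 1)) := fun i => by
    rw [← Real.sqrt_mul (by linarith [hG i]), show (2 * G i - 1) ^ 2 - 1 =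
      2 ^ 2 * (G i * (G i - 1)) by ring, Real.sqrt_mul (by norm_num),
      Real.sqrt_sq (by norm_num)]
  rw [tmsQuad, Matrix.fromBlocks_multiply]
  congr 1
  · ext i j
    rw [Matrix.add_apply, Matrix.diagonal_mul_diagonal, Matrix.mul_apply,
      Finset.sum_eq_single (Fin.castLE hNM i)]
    · by_cases hij : i = j
      · subst hij
        simp [h1, h2]
        ring
      · have : ¬ (j : ℕ) = i := fun h => hij (Fin.ext h.symm)
        simp [hij, this]
    · intro b _ hb
      have : ¬ (i : ℕ) = b := fun h => hb (Fin.ext h.symm)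
      simp [this]
    · simp
  · ext i a
    rw [Matrix.add_apply, Matrix.diagonal_mul, Matrix.mul_diagonal]
    by_cases hia : (i : ℕ) = a
    · have ha : (a : ℕ) < N := hia ▸ i.2
      have : (⟨a, ha⟩ : Fin N) = i := Fin.ext hia.symm
      simp [hia, ha, this, h3]
      ring
    · simp [hia]
  · ext a i
    rw [Matrix.add_apply, Matrix.diagonal_mul, Matrix.mul_diagonal]
    by_cases hia : (i : ℕ) = a
    · have ha : (a : ℕ) < N := hia ▸ i.2
      have : (⟨a, ha⟩ : Fin N) = i := Fin.ext hia.symm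
      simp [hia, ha, this, h3]
      ring
    · simp [hia]
  · ext a b
    rw [Matrix.add_apply, Matrix.diagonal_mul_diagonal, Matrix.mul_apply]
    by_cases ha : (a : ℕ) < N
    · rw [Finset.sum_eq_single (⟨a, ha⟩ : Fin N)]
      · by_cases hab : a = b
        · subst hab
          simp [ha, h1, h2]
          ring
        · have : ¬ (a : ℕ) = b := fun h => hab (Fin.ext h)
          simp [hab, this]
      · intro i _ hi
        have : ¬ (i : ℕ) = a := fun h => hi (Fin.ext h)
        simp [this]
      · simp
    · rw [Finset.sum_eq_zero]
      · by_cases hab : a = b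
        · subst hab
          simp [ha]
        · simp [hab]
      · intro i _
        have : ¬ (i : ℕ) = a := fun h => ha (h ▸ i.2)
        simp [this]

/-- The position and momentum blocks are inverse to each other, so inversion swaps them. -/
theorem tms_inv (hNM : N ≤ M) {G : Fin N → ℝ} (hG : ∀ i, 1 ≤ G i) :
    (tms G : Matrix ((Fin N ⊕ Fin M) ⊕ (Fin N ⊕ Fin M)) _ ℝ)⁻¹ =
      Matrix.fromBlocks (tmsQuad (-1) G) 0 0 (tmsQuad 1 G) := by
  have h := tmsQuad_mul hNM hG
  refine Matrix.inv_eq_right_inv ?_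
  rw [tms, Matrix.fromBlocks_multiply]
  simp [h, mul_eq_one_comm.1 h]

theorem tms_inv_mul_transpose (hNM : N ≤ M) {G : Fin N → ℝ} (hG : ∀ i, 1 ≤ G i) :
    (tms G : Matrix ((Fin N ⊕ Fin M) ⊕ (Fin N ⊕ Fin M)) _ ℝ)⁻¹ * ((tms G)⁻¹)ᵀ =
      Matrix.fromBlocks
        ((tmsQuad (-1) G : Matrix (Fin N ⊕ Fin M) (Fin N ⊕ Fin M) ℝ) * tmsQuad (-1) G) 0 0
        ((tmsQuad 1 G : Matrix (Fin N ⊕ Fin M) (Fin N ⊕ Fin M) ℝ) * tmsQuad 1 G) := by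
  rw [tms_inv hNM hG, Matrix.fromBlocks_transpose, tmsQuad_transpose, tmsQuad_transpose,
    Matrix.fromBlocks_multiply]
  simp

end Squeezers

/-! ### From the normal form to local symplectic matrices -/

section Decomposition

/-- The symplectic matrix `Ω = -J` as an operator on Euclidean phase space. -/
def omegaOp (ι : Type*) [Fintype ι] [DecidableEq ι] :
    EuclideanSpace ℝ (ι ⊕ ι) →ₗ[ℝ] EuclideanSpace ℝ (ι ⊕ ι) :=
  Matrix.toEuclideanLin (-Matrix.J ι ℝ)

variable {ι : Type*} [Fintype ι] [DecidableEq ι]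

theorem inner_omegaOp (x y : EuclideanSpace ℝ (ι ⊕ ι)) :
    inner ℝ x (omegaOp ι y) = omega x.ofLp y.ofLp := by
  rw [omega_eq, omegaOp, EuclideanSpace.inner_eq_star_dotProduct, dotProduct_comm]
  simp [Matrix.toLpLin_apply]

theorem inner_omegaOp_left (x y : EuclideanSpace ℝ (ι ⊕ ι)) :
    inner ℝ (omegaOp ι x) y = -inner ℝ x (omegaOp ι y) := by
  rw [real_inner_comm, inner_omegaOp, inner_omegaOp]
  simp only [omega, ← Finset.sum_neg_distrib]
  exact Finset.sum_congr rfl fun _ _ => by ring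

theorem omegaOp_omegaOp (x : EuclideanSpace ℝ (ι ⊕ ι)) : omegaOp ι (omegaOp ι x) = -x := by
  have := Matrix.J_squared ι ℝ
  simp [omegaOp, Matrix.toLpLin_apply, Matrix.neg_mulVec, Matrix.mulVec_neg,
    Matrix.mulVec_mulVec, this]

/-- The noise covariance `S⁻¹ S⁻ᵀ` of a decoded state is, up to local symplectic maps, the one of
two-mode squeezers. -/
theorem exists_localSum_mul_eq_tms {N M : ℕ} (hNM : N ≤ M)
    {S : Matrix ((Fin N ⊕ Fin M) ⊕ (Fin N ⊕ Fin M)) ((Fin N ⊕ Fin M) ⊕ (Fin N ⊕ Fin M)) ℝ}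
    (hS : S ∈ Matrix.symplecticGroup (Fin N ⊕ Fin M) ℝ) :
    ∃ (G : Fin N → ℝ) (_ : ∀ i, 1 ≤ G i)
      (A : Matrix (Fin N ⊕ Fin N) (Fin N ⊕ Fin N) ℝ)
      (_ : A ∈ Matrix.symplecticGroup (Fin N) ℝ)
      (B : Matrix (Fin M ⊕ Fin M) (Fin M ⊕ Fin M) ℝ)
      (_ : B ∈ Matrix.symplecticGroup (Fin M) ℝ),
      localSum A B * (S⁻¹ * (S⁻¹)ᵀ) * (localSum A B)ᵀ = (tms G)⁻¹ * ((tms G)⁻¹)ᵀ := by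
  have hSt : Sᵀ ∈ Matrix.symplecticGroup (Fin N ⊕ Fin M) ℝ := SymplecticGroup.transpose_mem hS
  have hdet : IsUnit Sᵀ.det := SymplecticGroup.symplectic_det hSt
  have hinv : ∀ z, Sᵀ *ᵥ ((Sᵀ)⁻¹ *ᵥ z) = z := fun z => by
    rw [Matrix.mulVec_mulVec, Matrix.mul_nonsing_inv _ hdet, Matrix.one_mulVec]
  have hinv' : ∀ z, (Sᵀ)⁻¹ *ᵥ (Sᵀ *ᵥ z) = z := fun z => by
    rw [Matrix.mulVec_mulVec, Matrix.nonsing_inv_mul _ hdet, Matrix.one_mulVec]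
  -- Ψ is S⁻ᵀ: it preserves ω, and the Euclidean inner product pulls back along it to the covariance
  -- S⁻¹S⁻ᵀ.
  let Ψ : Phase (Fin N) × Phase (Fin M) →ₗ[ℝ]
      EuclideanSpace ℝ ((Fin N ⊕ Fin M) ⊕ (Fin N ⊕ Fin M)) :=
    (WithLp.linearEquiv 2 ℝ _).symm.toLinearMap ∘ₗ Matrix.mulVecLin (Sᵀ)⁻¹ ∘ₗ joinLinear
  have hΨ : ∀ a b, Sᵀ *ᵥ (Ψ (a, b)).ofLp = joinPhase a b := fun a b => hinv _
  have hΨ' : ∀ x : EuclideanSpace ℝ _, x = Ψ (fstPart (Sᵀ *ᵥ x.ofLp), sndPart (Sᵀ *ᵥ x.ofLp)) := by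
    intro x
    refine (WithLp.linearEquiv 2 ℝ _).injective ?_
    change x.ofLp = (Sᵀ)⁻¹ *ᵥ joinPhase _ _
    rw [joinPhase_fstPart_sndPart, hinv']
  have hΨinj : Function.Injective Ψ := fun p q hpq => by
    have h := congrArg (fun x => Sᵀ *ᵥ x.ofLp) hpq
    simp only [hΨ p.1 p.2, hΨ q.1 q.2] at h
    exact Prod.ext (by simpa [fstPart_joinPhase] using congrArg fstPart h)
      (by simpa [sndPart_joinPhase] using congrArg sndPart h)
  have homega : ∀ a b c d, inner ℝ (Ψ (a, b)) (omegaOp _ (Ψ (c, d))) = omega a c + omega b d :=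
    fun a b c d => by
      rw [inner_omegaOp, ← omega_mulVec hSt, hΨ, hΨ, omega_joinPhase]
  let ψ₁ := Ψ ∘ₗ LinearMap.inl ℝ (Phase (Fin N)) (Phase (Fin M))
  let ψ₂ := Ψ ∘ₗ LinearMap.inr ℝ (Phase (Fin N)) (Phase (Fin M))
  let U := LinearMap.range ψ₁
  let V := LinearMap.range ψ₂
  have hU : ∀ x, x ∈ U ↔ ∀ y ∈ V, inner ℝ y (omegaOp _ x) = 0 := by
    intro x
    constructor
    · rintro ⟨a, rfl⟩ _ ⟨b, rfl⟩
      change inner ℝ (Ψ (0, b)) (omegaOp _ (Ψ (a, 0))) = 0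
      rw [homega, omega_zero_left, omega_zero_right, add_zero]
    · intro h
      rw [hΨ' x] at h ⊢
      refine ⟨fstPart (Sᵀ *ᵥ x.ofLp), ?_⟩
      rw [omega_eq_zero (x := sndPart (Sᵀ *ᵥ x.ofLp)) fun y => ?_]
      · rfl
      · have := h (Ψ (0, y)) ⟨y, rfl⟩
        rwa [homega, omega_zero_left, zero_add] at this
  have hV : ∀ x, x ∈ V ↔ ∀ y ∈ U, inner ℝ y (omegaOp _ x) = 0 := by
    intro x
    constructor
    · rintro ⟨b, rfl⟩ _ ⟨a, rfl⟩
      change inner ℝ (Ψ (a, 0)) (omegaOp _ (Ψ (0, b))) = 0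
      rw [homega, omega_zero_left, omega_zero_right, add_zero]
    · intro h
      rw [hΨ' x] at h ⊢
      refine ⟨sndPart (Sᵀ *ᵥ x.ofLp), ?_⟩
      rw [omega_eq_zero (x := fstPart (Sᵀ *ᵥ x.ofLp)) fun y => ?_]
      · rfl
      · have := h (Ψ (y, 0)) ⟨y, rfl⟩
        rwa [homega, omega_zero_left, add_zero] at this
  have hUV : Disjoint U V := by
    rw [Submodule.disjoint_def]
    rintro _ ⟨a, rfl⟩ ⟨b, hb⟩
    have h : ((0 : Phase (Fin N)), b) = (a, 0) := hΨinj hb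
    obtain rfl : 0 = a := (Prod.ext_iff.1 h).1
    exact map_zero ψ₁
  have hUdim : Module.finrank ℝ U = 2 * Fintype.card (Fin N) := by
    rw [LinearMap.finrank_range_of_inj (f := ψ₁) (hΨinj.comp LinearMap.inl_injective)]
    simp [two_mul]
  have hVdim : Module.finrank ℝ V = 2 * Fintype.card (Fin M) := by
    rw [LinearMap.finrank_range_of_inj (f := ψ₂) (hΨinj.comp LinearMap.inr_injective)]
    simp [two_mul]
  obtain ⟨e, f, ν, e', f', μ, h, h', hν, hμν, hμ, c1, c2, c3, c4⟩ :=
    exists_modewise_normal_form inner_omegaOp_left omegaOp_omegaOp hU hV hUV hUdim hVdim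
      (Fin.castLEEmb hNM)
  have hm : ∀ i, i ∈ (Finset.univ : Finset (Fin N)) := Finset.mem_univ
  have hm' : ∀ i, i ∈ (Finset.univ : Finset (Fin M)) := Finset.mem_univ
  have hUj : ∀ x ∈ U, Sᵀ *ᵥ x.ofLp = joinPhase (fstPart (Sᵀ *ᵥ x.ofLp)) 0 := by
    rintro _ ⟨a, rfl⟩
    change Sᵀ *ᵥ (Ψ (a, 0)).ofLp = joinPhase (fstPart (Sᵀ *ᵥ (Ψ (a, 0)).ofLp)) 0
    rw [hΨ, fstPart_joinPhase]
  have hVj : ∀ x ∈ V, Sᵀ *ᵥ x.ofLp = joinPhase 0 (sndPart (Sᵀ *ᵥ x.ofLp)) := by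
    rintro _ ⟨b, rfl⟩
    change Sᵀ *ᵥ (Ψ (0, b)).ofLp = joinPhase 0 (sndPart (Sᵀ *ᵥ (Ψ (0, b)).ofLp))
    rw [hΨ, sndPart_joinPhase]
  have hUo : ∀ x ∈ U, ∀ y ∈ U, omega (fstPart (Sᵀ *ᵥ x.ofLp)) (fstPart (Sᵀ *ᵥ y.ofLp)) =
      inner ℝ x (omegaOp _ y) := fun x hx y hy => by
    rw [inner_omegaOp, ← omega_mulVec hSt x.ofLp, hUj x hx, hUj y hy, omega_joinPhase,
      omega_zero_left, add_zero, fstPart_joinPhase, fstPart_joinPhase]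
  have hVo : ∀ x ∈ V, ∀ y ∈ V, omega (sndPart (Sᵀ *ᵥ x.ofLp)) (sndPart (Sᵀ *ᵥ y.ofLp)) =
      inner ℝ x (omegaOp _ y) := fun x hx y hy => by
    rw [inner_omegaOp, ← omega_mulVec hSt x.ofLp, hVj x hx, hVj y hy, omega_joinPhase,
      omega_zero_left, zero_add, sndPart_joinPhase, sndPart_joinPhase]
  -- The Williamson bases, brought back to phase space by Sᵀ, serve as rows.
  let A : Matrix (Fin N ⊕ Fin N) (Fin N ⊕ Fin N) ℝ :=
    Sum.elim (fun i => fstPart (Sᵀ *ᵥ (e i).ofLp)) (fun i => fstPart (Sᵀ *ᵥ (f i).ofLp))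
  let B : Matrix (Fin M ⊕ Fin M) (Fin M ⊕ Fin M) ℝ :=
    Sum.elim (fun i => sndPart (Sᵀ *ᵥ (e' i).ofLp)) (fun i => sndPart (Sᵀ *ᵥ (f' i).ofLp))
  let v : (Fin N ⊕ Fin M) ⊕ (Fin N ⊕ Fin M) → EuclideanSpace ℝ _ :=
    Sum.elim (Sum.elim e e') (Sum.elim f f')
  let K : Matrix ((Fin N ⊕ Fin M) ⊕ (Fin N ⊕ Fin M)) ((Fin N ⊕ Fin M) ⊕ (Fin N ⊕ Fin M)) ℝ :=
    fun a => (v a).ofLp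
  have hA : A ∈ Matrix.symplecticGroup (Fin N) ℝ := mem_symplecticGroup_of_rows
    (fun i j => (hUo _ (h.e_mem i (hm i)) _ (h.e_mem j (hm j))).trans (h.ee i (hm i) j (hm j)))
    (fun i j => (hUo _ (h.f_mem i (hm i)) _ (h.f_mem j (hm j))).trans (h.ff i (hm i) j (hm j)))
    (fun i j => (hUo _ (h.e_mem i (hm i)) _ (h.f_mem j (hm j))).trans (h.ef i (hm i) j (hm j)))
  have hB : B ∈ Matrix.symplecticGroup (Fin M) ℝ := mem_symplecticGroup_of_rows
    (fun i j => (hVo _ (h'.e_mem i (hm' i)) _ (h'.e_mem j (hm' j))).trans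
      (h'.ee i (hm' i) j (hm' j)))
    (fun i j => (hVo _ (h'.f_mem i (hm' i)) _ (h'.f_mem j (hm' j))).trans
      (h'.ff i (hm' i) j (hm' j)))
    (fun i j => (hVo _ (h'.e_mem i (hm' i)) _ (h'.f_mem j (hm' j))).trans
      (h'.ef i (hm' i) j (hm' j)))
  -- Sᵀ sends `U` to pure data vectors and `V` to pure ancilla vectors, so K S is block diagonal.
  -- The transformed covariance is therefore the Gram matrix K Kᵀ.
  have hKS : localSum A B = K * S := by
    have hrow : ∀ a, (K * S) a = Sᵀ *ᵥ (v a).ofLp := fun a => by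
      rw [Matrix.mulVec_transpose]
      rfl
    ext ((i | i) | (i | i)) b <;> rw [hrow]
    · change _ = (Sᵀ *ᵥ (e i).ofLp) b
      rw [hUj _ (h.e_mem i (hm i))]
      rcases b with ((j | j) | (j | j)) <;> rfl
    · change _ = (Sᵀ *ᵥ (e' i).ofLp) b
      rw [hVj _ (h'.e_mem i (hm' i))]
      rcases b with ((j | j) | (j | j)) <;> rfl
    · change _ = (Sᵀ *ᵥ (f i).ofLp) b
      rw [hUj _ (h.f_mem i (hm i))]
      rcases b with ((j | j) | (j | j)) <;> rfl
    · change _ = (Sᵀ *ᵥ (f' i).ofLp) b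
      rw [hVj _ (h'.f_mem i (hm' i))]
      rcases b with ((j | j) | (j | j)) <;> rfl
  have hK : localSum A B * S⁻¹ = K := by
    rw [hKS, Matrix.mul_assoc, Matrix.mul_nonsing_inv _ (SymplecticGroup.symplectic_det hS),
      Matrix.mul_one]
  have hKK : ∀ a b, (K * Kᵀ) a b = inner ℝ (v a) (v b) := fun a b => by
    rw [EuclideanSpace.inner_eq_star_dotProduct, dotProduct_comm]
    rfl
  let G : Fin N → ℝ := fun i => (ν i + 1) / 2
  have hG : ∀ i, 1 ≤ G i := fun i => by
    have := hν i
    simp only [G]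
    linarith
  have hGν : ∀ i, 2 * G i - 1 = ν i := fun i => by simp only [G]; ring
  have hμG : ∀ a : Fin M, (if h : (a : ℕ) < N then 2 * G ⟨a, h⟩ - 1 else 1) = μ a := fun a => by
    split_ifs with ha
    · rw [hGν, ← hμν]
      rfl
    · refine (hμ a fun i hi => ha ?_).symm
      rw [← hi]
      exact i.2
  have hcast : ∀ (i : Fin N) (a : Fin M), Fin.castLEEmb hNM i = a ↔ (i : ℕ) = a := fun i a =>
    Fin.ext_iff
  refine ⟨G, hG, A, hA, B, hB, ?_⟩
  rw [show localSum A B * (S⁻¹ * (S⁻¹)ᵀ) * (localSum A B)ᵀ =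
      (localSum A B * S⁻¹) * (localSum A B * S⁻¹)ᵀ by
    rw [Matrix.transpose_mul]; simp only [Matrix.mul_assoc], hK, tms_inv_mul_transpose hNM hG,
    tmsQuad_mul_self hNM (by norm_num) hG, tmsQuad_mul_self hNM (by norm_num) hG]
  simp only [hμG]
  simp only [hGν]
  simp only [hcast] at c1 c2
  ext ((i | i) | (i | i)) ((j | j) | (j | j)) <;> rw [hKK]
  · simpa [v, Matrix.diagonal_apply] using h.inner_e_e (hm i) (hm j)
  · simpa [v] using c1 i j
  · simpa [v] using h.inner_e_f (hm i) (hm j)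
  · simpa [v] using c3 i j
  · simpa [v, real_inner_comm] using c1 j i
  · simpa [v, Matrix.diagonal_apply] using h'.inner_e_e (hm' i) (hm' j)
  · simpa [v, real_inner_comm] using c4 j i
  · simpa [v] using h'.inner_e_f (hm' i) (hm' j)
  · simpa [v] using h.inner_f_e (hm i) (hm j)
  · simpa [v] using c4 i j
  · simpa [v, Matrix.diagonal_apply] using h.inner_f_f inner_omegaOp_left (hm i) (hm j)
  · simpa [v] using c2 i j
  · simpa [v, real_inner_comm] using c3 j i
  · simpa [v] using h'.inner_f_e (hm' i) (hm' j)
  · simpa [v, real_inner_comm] using c2 j i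
  · simpa [v, Matrix.diagonal_apply] using h'.inner_f_f inner_omegaOp_left (hm' i) (hm' j)

end Decomposition


/-! ### Noise and decoding on characteristic functions -/

/-- The average of the phases factors into one-dimensional Gaussian characteristic functions; the
damping sees only the length of ζ. -/
theorem agn_apply {ι : Type*} [Fintype ι] (σ : ℝ≥0) (χ : CharFn ι) (ζ : Phase ι) :
    agn σ χ ζ = Complex.exp (-(((σ : ℝ) ^ 2 * (ζ ⬝ᵥ ζ) / 2 : ℝ) : ℂ)) * χ ζ := by
  -- ζ after a quarter turn: ω(ζ, ξ) = c · ξ, and |c| = |ζ|.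
  let c : ι ⊕ ι → ℝ := Sum.elim (fun i => -ζ (Sum.inr i)) (fun i => ζ (Sum.inl i))
  have h1 : ∀ ξ : Phase ι, Complex.exp (Complex.I * (omega ζ ξ : ℂ)) =
      ∏ k, Complex.exp ((c k : ℂ) * (ξ k : ℂ) * Complex.I) := fun ξ => by
    rw [← Complex.exp_sum, ← Finset.sum_mul, mul_comm]
    congr 2
    simp [omega, c, Fintype.sum_sum_type, Finset.sum_sub_distrib]
    ring
  have h2 : ∀ k, ∫ x : ℝ, Complex.exp ((c k : ℂ) * (x : ℂ) * Complex.I) ∂(gaussianReal 0 (σ ^ 2)) =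
      Complex.exp (-(((σ : ℝ) ^ 2 * (c k * c k) / 2 : ℝ) : ℂ)) := fun k => by
    rw [← charFun_apply_real, charFun_gaussianReal]
    congr 1
    push_cast
    ring
  simp only [agn, displace]
  rw [integral_mul_const]
  congr 1
  simp only [h1]
  rw [integral_fintype_prod_eq_prod (f := fun k (x : ℝ) =>
    Complex.exp ((c k : ℂ) * (x : ℂ) * Complex.I))]
  simp only [h2]
  rw [← Complex.exp_sum, Finset.sum_neg_distrib, ← Complex.ofReal_sum, ← Finset.sum_div,
    ← Finset.mul_sum]
  have : ∑ k, c k * c k = ζ ⬝ᵥ ζ := by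
    simp [c, dotProduct, Fintype.sum_sum_type, add_comm]
  rw [this]

variable {N M : ℕ} {Y : Type*} [MeasurableSpace Y]

theorem inv_mulVec_mulVec {ι : Type*} [Fintype ι] [DecidableEq ι] {S : Matrix (ι ⊕ ι) (ι ⊕ ι) ℝ}
    (hS : S ∈ Matrix.symplecticGroup ι ℝ) (ζ : Phase ι) : S⁻¹ *ᵥ (S *ᵥ ζ) = ζ := by
  rw [Matrix.mulVec_mulVec, Matrix.nonsing_inv_mul _ (SymplecticGroup.symplectic_det hS),
    Matrix.one_mulVec]

theorem mulVec_inv_mulVec {ι : Type*} [Fintype ι] [DecidableEq ι] {S : Matrix (ι ⊕ ι) (ι ⊕ ι) ℝ}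
    (hS : S ∈ Matrix.symplecticGroup ι ℝ) (ζ : Phase ι) : S *ᵥ (S⁻¹ *ᵥ ζ) = ζ := by
  rw [Matrix.mulVec_mulVec, Matrix.mul_nonsing_inv _ (SymplecticGroup.symplectic_det hS),
    Matrix.one_mulVec]

/-- Encoding and decoding cancel on the product state, but the damping factor in between is
evaluated at the encoded vector. -/
theorem Code.decoded_apply (C : Code N M Y) (σ : ℝ≥0) (ρ : CharFn (Fin N))
    (ζ : Phase (Fin N ⊕ Fin M)) :
    C.decoded σ ρ ζ =
      Complex.exp (-(((σ : ℝ) ^ 2 * ((C.enc *ᵥ ζ) ⬝ᵥ (C.enc *ᵥ ζ)) / 2 : ℝ) : ℂ)) *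
        tensor ρ C.ancilla ζ := by
  have hS := SymplecticGroup.symplectic_det C.enc_mem
  rw [Code.decoded, gaussian, Matrix.nonsing_inv_nonsing_inv _ hS, agn_apply, gaussian,
    inv_mulVec_mulVec C.enc_mem]

/-- Equality of the covariances says that T X S⁻¹ is orthogonal, and this matrix maps Sζ to T X ζ.
-/
theorem dotProduct_mulVec_eq_of_mul_transpose_eq {n : Type*} [Fintype n] [DecidableEq n]
    {S T X : Matrix n n ℝ} (hS : IsUnit S.det) (hT : IsUnit T.det)
    (h : X * (S⁻¹ * (S⁻¹)ᵀ) * Xᵀ = T⁻¹ * (T⁻¹)ᵀ) (ζ : n → ℝ) :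
    (T *ᵥ (X *ᵥ ζ)) ⬝ᵥ (T *ᵥ (X *ᵥ ζ)) = (S *ᵥ ζ) ⬝ᵥ (S *ᵥ ζ) := by
  have h1 : (T * X * S⁻¹) * (T * X * S⁻¹)ᵀ = 1 := by
    calc (T * X * S⁻¹) * (T * X * S⁻¹)ᵀ = T * (X * (S⁻¹ * (S⁻¹)ᵀ) * Xᵀ) * Tᵀ := by
          simp only [Matrix.transpose_mul, Matrix.mul_assoc]
      _ = (T * T⁻¹) * (T * T⁻¹)ᵀ := by
          rw [h]
          simp only [Matrix.transpose_mul, Matrix.mul_assoc]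
      _ = 1 := by rw [Matrix.mul_nonsing_inv _ hT, Matrix.transpose_one, Matrix.mul_one]
  have h2 := mul_eq_one_comm.1 h1
  have h3 : T *ᵥ (X *ᵥ ζ) = (T * X * S⁻¹) *ᵥ (S *ᵥ ζ) := by
    rw [Matrix.mulVec_mulVec, Matrix.mulVec_mulVec, Matrix.mul_assoc (T * X),
      Matrix.nonsing_inv_mul _ hS, Matrix.mul_one]
  rw [h3, Matrix.dotProduct_mulVec, Matrix.vecMul_mulVec, h2, Matrix.vecMul_one]

/-! ### Transfer of channels and lattice codes -/

section toTMS

variable (hNM : N ≤ M) {G : Fin N → ℝ} (hG : ∀ i, 1 ≤ G i)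
  {A : Matrix (Fin N ⊕ Fin N) (Fin N ⊕ Fin N) ℝ}
  {B : Matrix (Fin M ⊕ Fin M) (Fin M ⊕ Fin M) ℝ} (hB : B ∈ Matrix.symplecticGroup (Fin M) ℝ)

theorem Code.decoded_toTMS (hA : A ∈ Matrix.symplecticGroup (Fin N) ℝ) (C : Code N M Y)
    (h : localSum A B * (C.enc⁻¹ * (C.enc⁻¹)ᵀ) * (localSum A B)ᵀ = (tms G)⁻¹ * ((tms G)⁻¹)ᵀ)
    (σ : ℝ≥0) (ρ : CharFn (Fin N)) (a : Phase (Fin N)) (b : Phase (Fin M)) :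
    (C.toTMS hNM G hG A B hB).decoded σ (gaussian A ρ) (joinPhase (A *ᵥ a) (B *ᵥ b)) =
      C.decoded σ ρ (joinPhase a b) := by
  have hT := SymplecticGroup.symplectic_det (tms_mem hNM hG)
  rw [Code.decoded_apply, Code.decoded_apply, ← dotProduct_mulVec_eq_of_mul_transpose_eq
    (SymplecticGroup.symplectic_det C.enc_mem) hT h, localSum_mulVec]
  simp only [tensor, fstPart_joinPhase, sndPart_joinPhase, gaussian, Code.toTMS,
    inv_mulVec_mulVec hA, inv_mulVec_mulVec hB]

/-- At A a, the conjugated measurement pulls the decoded function back along `B` and so sees the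
original one at a; the correction phase agrees because `A` preserves ω. -/
theorem Code.channel_toTMS (hA : A ∈ Matrix.symplecticGroup (Fin N) ℝ) (C : Code N M Y)
    (h : localSum A B * (C.enc⁻¹ * (C.enc⁻¹)ᵀ) * (localSum A B)ᵀ = (tms G)⁻¹ * ((tms G)⁻¹)ᵀ)
    (σ : ℝ≥0) (ρ : CharFn (Fin N)) :
    (C.toTMS hNM G hG A B hB).channel σ (gaussian A ρ) = gaussian A (C.channel σ ρ) := by
  ext ζ
  obtain ⟨a, rfl⟩ : ∃ a, ζ = A *ᵥ a := ⟨A⁻¹ *ᵥ ζ, (mulVec_inv_mulVec hA ζ).symm⟩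
  rw [gaussian, inv_mulVec_mulVec hA]
  have h1 : pullback B (fun ν => (C.toTMS hNM G hG A B hB).decoded σ (gaussian A ρ)
      (joinPhase (A *ᵥ a) ν)) = fun ν => C.decoded σ ρ (joinPhase a ν) :=
    funext fun b => Code.decoded_toTMS hNM hG hB hA C h σ ρ a b
  have h2 : ∀ s, omega (A *ᵥ a) (-(C.toTMS hNM G hG A B hB).est s) = omega a (-C.est s) :=
    fun s => by
      rw [← omega_mulVec hA a, Matrix.mulVec_neg]
      rfl
  change (C.meas.rule (pullback B _)).integral _ _ = (C.meas.rule _).integral _ _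
  rw [h1]
  simp only [h2]

theorem IsLatticeGenerator.mul {L : Matrix (Fin M ⊕ Fin M) (Fin (2 * M)) ℝ}
    (hB : B ∈ Matrix.symplecticGroup (Fin M) ℝ) (h : IsLatticeGenerator L) :
    IsLatticeGenerator (B * L) := by
  obtain ⟨Q, hQ, hdet⟩ := h
  exact ⟨Q, fun j k => (omega_mulVec hB _ _).trans (hQ j k), hdet⟩

theorem IsLatticeState.mul {L : Matrix (Fin M ⊕ Fin M) (Fin (2 * M)) ℝ} {χ : CharFn (Fin M)}
    (hB : B ∈ Matrix.symplecticGroup (Fin M) ℝ) (h : IsLatticeState L χ) :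
    IsLatticeState (B * L) (gaussian B χ) := by
  refine ⟨isState_gaussian hB h.1, fun j => ?_⟩
  change χ (B⁻¹ *ᵥ (-(√(2 * Real.pi) • (B *ᵥ fun a => L a j)))) = 1
  rw [← Matrix.mulVec_smul, ← Matrix.mulVec_neg, inv_mulVec_mulVec hB, h.2]

/-- The ordering phases depend only on the symplectic Gram matrix, which `B` preserves, and pulling
back along `B` evaluates the state at B L k in place of L k. -/
theorem IsStabilizerMeasurement.mul {L : Matrix (Fin M ⊕ Fin M) (Fin (2 * M)) ℝ}
    {P : Measurement (Fin M) (Syndrome M)} (hB : B ∈ Matrix.symplecticGroup (Fin M) ℝ)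
    (h : IsStabilizerMeasurement L P) : IsStabilizerMeasurement (B * L) (P.conj B hB) := by
  intro χ hχ k
  have := h _ (isPositive_pullback hB hχ) k
  have h1 : ∀ j l, omega (√(2 * Real.pi) • fun a => (B * L) a j)
      (√(2 * Real.pi) • fun a => (B * L) a l) =
      omega (√(2 * Real.pi) • fun a => L a j) (√(2 * Real.pi) • fun a => L a l) := fun j l => by
    rw [← omega_mulVec hB (√(2 * Real.pi) • fun a => L a j), Matrix.mulVec_smul,
      Matrix.mulVec_smul]
    rfl
  simp only [h1]
  rw [← Matrix.mulVec_mulVec, ← Matrix.mulVec_smul, ← Matrix.mulVec_neg]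
  exact this

theorem Code.IsLatticeCode.toTMS {C : Code N M (Syndrome M)}
    {L : Matrix (Fin M ⊕ Fin M) (Fin (2 * M)) ℝ} (h : C.IsLatticeCode L) :
    (C.toTMS hNM G hG A B hB).IsLatticeCode (B * L) :=
  ⟨h.generator.mul hB, h.state.mul hB, h.stabilizer.mul hB⟩

end toTMS

end O2O

end

theorem theorem3 (N M : ℕ) (hNM : N ≤ M)
    (S : Matrix ((Fin N ⊕ Fin M) ⊕ (Fin N ⊕ Fin M)) ((Fin N ⊕ Fin M) ⊕ (Fin N ⊕ Fin M)) ℝ)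
    (hS : S ∈ Matrix.symplecticGroup (Fin N ⊕ Fin M) ℝ) :
    ∃ (G : Fin N → ℝ) (hG : ∀ i, 1 ≤ G i)
      (A : Matrix (Fin N ⊕ Fin N) (Fin N ⊕ Fin N) ℝ)
      (_ : A ∈ Matrix.symplecticGroup (Fin N) ℝ)
      (B : Matrix (Fin M ⊕ Fin M) (Fin M ⊕ Fin M) ℝ)
      (hB : B ∈ Matrix.symplecticGroup (Fin M) ℝ),
      -- the correlated noise after decoding is that of the squeezers, up to local operations
      (∀ σ : ℝ≥0,
        O2O.localSum A B * ((σ : ℝ) ^ 2 • (S⁻¹ * (S⁻¹)ᵀ)) * (O2O.localSum A B)ᵀ =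
          (σ : ℝ) ^ 2 • ((O2O.tms G)⁻¹ * ((O2O.tms G)⁻¹)ᵀ)) ∧
      -- every code with encoding `S` acts, up to `U_A` on the data, as a squeezing code
      (∀ (Y : Type*) [MeasurableSpace Y] (C : O2O.Code N M Y), C.enc = S →
        ∀ (σ : ℝ≥0) (ρ : O2O.CharFn (Fin N)), O2O.IsState ρ →
          (C.toTMS hNM G hG A B hB).channel σ (O2O.gaussian A ρ) =
            O2O.gaussian A (C.channel σ ρ)) ∧
      -- lattice codes become lattice codes
      (∀ (C : O2O.Code N M (O2O.Syndrome M)) (L : Matrix (Fin M ⊕ Fin M) (Fin (2 * M)) ℝ),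
        C.enc = S → C.IsLatticeCode L →
          (C.toTMS hNM G hG A B hB).IsLatticeCode (B * L)) := by
  obtain ⟨G, hG, A, hA, B, hB, h⟩ := O2O.exists_localSum_mul_eq_tms hNM hS
  refine ⟨G, hG, A, hA, B, hB, fun σ => ?_, ?_, ?_⟩
  · rw [Matrix.mul_smul, Matrix.smul_mul, h]
  · rintro Y _ C rfl σ ρ -
    exact O2O.Code.channel_toTMS hNM hG hB hA C h σ ρ
  · rintro C L rfl hC
    exact hC.toTMS hNM hG hB
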